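/- Let $n \ge 1$, let $\mathbb{B}_n$ be the open unit ball of $\mathbb{C}^n$, and let $dv$ be Lebesgue measure on $\mathbb{B}_n$ normalized by $v(\mathbb{B}_n)=1$. For $1<p<\infty$ let $A^p$ be the Bergman space of all holomorphic functions $f$ on $\mathbb{B}_n$ with $\|f\|_{A^p}^p=\int_{\mathbb{B}_n}|f|^p\,dv<\infty$, let $p'$ be given by $\frac1p+\frac1{p'}=1$, and write $\langle f,g\rangle_{A^2}=\int_{\mathbb{B}_n} f\,\overline{g}\,dv$ for $f\in A^p$, $g\in A^{p'}$. For $z,w\in\mathbb{B}_n$ write $\overline{z}w=\sum_i \overline{z_i}w_i$ and put $$K_z(w)=\frac{1}{(1-\overline{z}w)^{n+1}},\qquad k_z=(1-|z|^2)^{\frac{n+1}{2}}K_z,\qquad k_z^{(p)}=\frac{K_z}{\|K_z\|_{A^2}^{2/p'}},\qquad k_z^{(p')}=\frac{K_z}{\|K_z\|_{A^2}^{2/p}}.$$ Let $\varphi_z$ be the Möbius involution of $\mathbb{B}_n$ that interchanges $0$ and $z$, that is, $$\varphi_z(w)=\frac{z-P_zw-(1-|z|^2)^{1/2}(w-P_zw)}{1-\overline{z}w},$$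 where $P_z$ is the orthogonal projection of $\mathbb{C}^n$ onto the linear span of $z$. Let $\rho(z,w)=|\varphi_z(w)|$, $\beta(z,w)=\frac12\log\frac{1+\rho(z,w)}{1-\rho(z,w)}$ and $D(z,r)=\{w\in\mathbb{B}_n:\beta(z,w)\le r\}$. If $T$ is any bounded linear operator on $A^p$, $1<p<\infty$, then the following are equivalent: (a) $\lim_{|z|\to1^-}\sup_{w\in D(z,r)}|\langle Tk_z^{(p)},k_w^{(p')}\rangle_{A^2}|=0$ for all $r>0$; (b) $\lim_{|z|\to1^-}\sup_{w\in D(z,r)}|\langle Tk_z^{(p)},k_w^{(p')}\rangle_{A^2}|=0$ for some $r>0$; (c) $\lim_{|z|\to1^-}|\langle Tk_z,k_z\rangle_{A^2}|=0$. -/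

import Mathlib

open MeasureTheory Filter Topology
open scoped ENNReal ComplexConjugate

noncomputable section

namespace Bergman

/-- The space `ℂⁿ` with its Euclidean (Hermitian) norm. -/
abbrev Cn (n : ℕ) : Type := EuclideanSpace ℂ (Fin n)

/-- The open unit ball of `ℂⁿ`, as a set. -/
abbrev unitBall (n : ℕ) : Set (Cn n) := Metric.ball (0 : Cn n) 1

/-- Lebesgue measure on the unit ball of `ℂⁿ`, normalized to have total mass one. -/
def ballMeasure (n : ℕ) : Measure (Cn n) :=
  (volume (unitBall n))⁻¹ • volume.restrict (unitBall n)

/-- The Bergman space `A^p`: the (classes of) functions in `L^p` of the normalized Lebesgue measure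
on the unit ball which are holomorphic there, with the norm of `L^p`. -/
def Ap (n : ℕ) (p : ℝ≥0∞) : Submodule ℂ (Lp ℂ p (ballMeasure n)) where
  carrier := {f | ∃ g : Cn n → ℂ, DifferentiableOn ℂ g (unitBall n) ∧ f =ᵐ[ballMeasure n] g}
  add_mem' := by
    rintro f₁ f₂ ⟨g₁, h₁, e₁⟩ ⟨g₂, h₂, e₂⟩
    exact ⟨g₁ + g₂, h₁.add h₂, (Lp.coeFn_add f₁ f₂).trans (e₁.add e₂)⟩
  zero_mem' := ⟨0, differentiableOn_const 0, Lp.coeFn_zero ℂ p (ballMeasure n)⟩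
  smul_mem' := by
    rintro c f ⟨g, h, e⟩
    exact ⟨c • g, h.const_smul c, (Lp.coeFn_smul c f).trans (e.const_smul c)⟩

/-- The pairing `⟨f, g⟩_{A²} = ∫ f \bar g dv` between `A^p` and `A^q` (used for conjugate
exponents, where the integrand is integrable by Hölder's inequality). -/
def pairing {n : ℕ} {p q : ℝ≥0∞} (f : Ap n p) (g : Ap n q) : ℂ :=
  ∫ x, (f : Lp ℂ p (ballMeasure n)) x * conj ((g : Lp ℂ q (ballMeasure n)) x) ∂(ballMeasure n)

/-- The Bergman kernel `K_z(w) = (1 - \bar z w)^{-(n+1)}`, where `\bar z w = ∑ \bar z_i w_i`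
(the inner product of Mathlib is conjugate-linear in its first argument). -/
def kernelFun {n : ℕ} (z w : Cn n) : ℂ := ((1 - inner ℂ z w) ^ (n + 1))⁻¹

theorem one_sub_norm_le {n : ℕ} (z : Cn n) {w : Cn n} (hw : w ∈ unitBall n) :
    1 - ‖z‖ ≤ ‖1 - inner ℂ z w‖ := by
  have h1 : ‖inner ℂ z w‖ ≤ ‖z‖ * ‖w‖ := norm_inner_le_norm z w
  have h2 : ‖w‖ ≤ 1 := (mem_ball_zero_iff.mp hw).le
  have h3 : ‖(1 : ℂ)‖ - ‖inner ℂ z w‖ ≤ ‖1 - inner ℂ z w‖ := norm_sub_norm_le _ _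
  have h4 : ‖z‖ * ‖w‖ ≤ ‖z‖ := mul_le_of_le_one_right (norm_nonneg z) h2
  rw [norm_one] at h3
  linarith

theorem kernelFun_differentiableOn {n : ℕ} (z : unitBall n) :
    DifferentiableOn ℂ (kernelFun (z : Cn n)) (unitBall n) := by
  have hz : ‖(z : Cn n)‖ < 1 := mem_ball_zero_iff.mp z.2
  have hd : Differentiable ℂ (fun w : Cn n => (1 - inner ℂ (z : Cn n) w) ^ (n + 1)) :=
    ((differentiable_const (1 : ℂ)).sub (innerSL ℂ (z : Cn n)).differentiable).pow (n + 1)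
  refine hd.differentiableOn.inv fun w hw => pow_ne_zero _ ?_
  have := one_sub_norm_le (z : Cn n) hw
  exact norm_pos_iff.mp (by linarith)

theorem kernelFun_memLp {n : ℕ} (p : ℝ≥0∞) (z : unitBall n) :
    MemLp (kernelFun (z : Cn n)) p (ballMeasure n) := by
  have hz : ‖(z : Cn n)‖ < 1 := mem_ball_zero_iff.mp z.2
  have hv : volume (unitBall n) ≠ 0 := (Metric.measure_ball_pos volume (0 : Cn n) one_pos).ne'
  have hfin : IsFiniteMeasure (volume.restrict (unitBall n)) :=
    ⟨by rw [Measure.restrict_apply_univ]; exact measure_ball_lt_top⟩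
  refine MemLp.smul_measure ?_ (ENNReal.inv_ne_top.mpr hv)
  refine MemLp.of_bound
    ((kernelFun_differentiableOn z).continuousOn.aestronglyMeasurable
      Metric.isOpen_ball.measurableSet)
    (((1 - ‖(z : Cn n)‖) ^ (n + 1))⁻¹) ?_
  filter_upwards [ae_restrict_mem Metric.isOpen_ball.measurableSet] with w hw
  have h0 : 0 < 1 - ‖(z : Cn n)‖ := by linarith
  have h1 := one_sub_norm_le (z : Cn n) hw
  rw [kernelFun, norm_inv, norm_pow]
  gcongr

/-- The Bergman kernel `K_z` as an element of `A^p`. -/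
def K {n : ℕ} (p : ℝ≥0∞) (z : unitBall n) : Ap n p :=
  ⟨(kernelFun_memLp p z).toLp _, kernelFun (z : Cn n), kernelFun_differentiableOn z,
    (kernelFun_memLp p z).coeFn_toLp⟩

/-- The normalized reproducing kernel `k_z = (1 - |z|²)^{(n+1)/2} K_z`, as an element of `A^p`. -/
def k {n : ℕ} (p : ℝ≥0∞) (z : unitBall n) : Ap n p :=
  (((1 - ‖(z : Cn n)‖ ^ 2) ^ (((n : ℝ) + 1) / 2) : ℝ) : ℂ) • K p z

/-- `kNorm p p' z` is the `p`-normalized reproducing kernel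
`k_z^{(p)} = K_z / ‖K_z‖_{A²}^{2/p'}` in `A^p`, where `p'` is the exponent conjugate to `p`. -/
def kNorm {n : ℕ} (p p' : ℝ≥0∞) (z : unitBall n) : Ap n p :=
  (((‖K 2 z‖ ^ (2 / p'.toReal))⁻¹ : ℝ) : ℂ) • K p z

/-- The Möbius involution `φ_z` of the unit ball that interchanges `0` and `z`:
`φ_z(w) = (z - P_z w - (1 - |z|²)^{1/2} (w - P_z w)) / (1 - \bar z w)` with `P_z` the orthogonal
projection onto the line `ℂ z` (and `P_0 = 0`). -/
def mobius {n : ℕ} (z w : Cn n) : Cn n :=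
  let Pw : Cn n := (ℂ ∙ z).starProjection w
  (1 - inner ℂ z w)⁻¹ • (z - Pw - ((Real.sqrt (1 - ‖z‖ ^ 2) : ℝ) : ℂ) • (w - Pw))

/-- The pseudohyperbolic metric `ρ(z, w) = |φ_z(w)|`. -/
def rho {n : ℕ} (z w : unitBall n) : ℝ := ‖mobius (z : Cn n) (w : Cn n)‖

/-- The Bergman metric `β(z, w) = ½ log ((1 + ρ(z, w)) / (1 - ρ(z, w)))`. -/
def beta {n : ℕ} (z w : unitBall n) : ℝ := 1 / 2 * Real.log ((1 + rho z w) / (1 - rho z w))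

/-- The closed hyperbolic disc `D(z, r) = {w : β(z, w) ≤ r}`. -/
def D {n : ℕ} (z : unitBall n) (r : ℝ) : Set (unitBall n) := {w | beta z w ≤ r}

/-- The filter on the unit ball describing `|z| → 1⁻`. -/
def toBoundary (n : ℕ) : Filter (unitBall n) :=
  comap (fun z : unitBall n => ‖(z : Cn n)‖) (𝓝[<] 1)

/-- `lim_{|z| → 1⁻} sup_{w ∈ D(z, r)} |⟨T k_z^{(p)}, k_w^{(p')}⟩| = 0`, the supremum being taken
in `[0, ∞]`. -/
def VanishesOnDiscs {n : ℕ} {p : ℝ≥0∞} [Fact (1 ≤ p)] (p' : ℝ≥0∞) (T : Ap n p →L[ℂ] Ap n p)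
    (r : ℝ) : Prop :=
  Tendsto (fun z : unitBall n => ⨆ w ∈ D z r, ‖pairing (T (kNorm p p' z)) (kNorm p' p w)‖ₑ)
    (toBoundary n) (𝓝 0)

end Bergman

end

/-!
The kernel `F_z(a, b) = (1 - |z|²)^{n+1} ⟨T(K_z · (K_a ∘ φ_z)), K_z · (K_b ∘ φ_z)⟩` of `T`, rescaled
at `z`, is a power series in `\bar a` and `b` whose coefficients are bounded uniformly in `z`,
because the kernels `k_z^{(p)}` are bounded in `A^p`. Since `K_z · (K_a ∘ φ_z) = K_a(z) K_{φ_z(a)}`,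
`|F_z(a, a)|` is `(1 - |a|²)^{-(n+1)}` times the Berezin transform at `φ_z(a)`, while `|F_z(0, b)|`
is comparable to `|⟨T k_z^{(p)}, k_{φ_z(b)}^{(p')}⟩|` for `|b| ≤ t < 1`.

If the Berezin transform vanishes at the boundary, then `F_z(λa, λa)`, a double power series in
`\bar λ` and `λ`, tends to zero uniformly for `|λ| ≤ 1/2`. Orthogonality of the monomials on circles
shows that its coefficients of degree zero in `\bar λ` tend to zero, so `F_z(0, b) → 0` uniformly
for `|b| ≤ t`; and the points `φ_z(b)`, `|b| ≤ t`, exhaust the hyperbolic disc `D(z, r)` once `t` is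
close to one.
-/

noncomputable section

namespace Bergman

/-! ### The Möbius involutions -/

section InnerProductSpace

variable {E : Type*} [NormedAddCommGroup E] {z w : E}

theorem one_sub_norm_pos (hz : z ∈ Metric.ball 0 1) : 0 < 1 - ‖z‖ :=
  sub_pos.mpr (mem_ball_zero_iff.mp hz)

theorem one_sub_norm_sq_pos (hz : z ∈ Metric.ball 0 1) : 0 < 1 - ‖z‖ ^ 2 :=
  sub_pos.mpr (pow_lt_one₀ (norm_nonneg z) (mem_ball_zero_iff.mp hz) two_ne_zero)

/-- The factor `s_z = (1 - |z|²)^{1/2}` by which `φ_z` contracts the directions orthogonal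
to `z`. -/
def mobiusScale (z : E) : ℂ := √(1 - ‖z‖ ^ 2)

theorem mobiusScale_sq (hz : z ∈ Metric.ball 0 1) : mobiusScale z ^ 2 = 1 - (‖z‖ : ℂ) ^ 2 := by
  rw [mobiusScale, ← Complex.ofReal_pow, Real.sq_sqrt (one_sub_norm_sq_pos hz).le]
  simp

theorem norm_mobiusScale_sq (hz : z ∈ Metric.ball 0 1) : ‖mobiusScale z‖ ^ 2 = 1 - ‖z‖ ^ 2 := by
  rw [mobiusScale, Complex.norm_real, Real.norm_of_nonneg (Real.sqrt_nonneg _),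
    Real.sq_sqrt (one_sub_norm_sq_pos hz).le]

theorem mobiusScale_ne_zero (hz : z ∈ Metric.ball 0 1) : mobiusScale z ≠ 0 :=
  Complex.ofReal_ne_zero.mpr (Real.sqrt_pos.mpr (one_sub_norm_sq_pos hz)).ne'

theorem one_add_mobiusScale_ne_zero (z : E) : 1 + mobiusScale z ≠ 0 := by
  rw [mobiusScale, ← Complex.ofReal_one, ← Complex.ofReal_add]
  exact Complex.ofReal_ne_zero.mpr (by positivity)

variable [InnerProductSpace ℂ E]

theorem one_sub_inner_ne_zero (hz : z ∈ Metric.ball 0 1) (hw : w ∈ Metric.ball 0 1) :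
    1 - inner ℂ z w ≠ 0 := by
  have h : ‖inner ℂ z w‖ < 1 := (norm_inner_le_norm z w).trans_lt <|
    mul_lt_one_of_nonneg_of_lt_one_left (norm_nonneg z) (mem_ball_zero_iff.mp hz)
      (mem_ball_zero_iff.mp hw).le
  refine sub_ne_zero.mpr fun h1 => ?_
  rw [← h1, norm_one] at h
  exact lt_irrefl _ h

theorem norm_one_sub_inner_comm (z w : E) : ‖1 - inner ℂ z w‖ = ‖1 - inner ℂ w z‖ := by
  rw [← RCLike.norm_conj, map_sub, map_one, inner_conj_symm]

theorem inner_self_eq_ofReal_norm_sq (z : E) : inner ℂ z z = (‖z‖ : ℂ) ^ 2 := by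
  simp [inner_self_eq_norm_sq_to_K]

/-- The linear map `A_z = P_z + s_z (1 - P_z)` in the numerator of `φ_z`. It is written here
without the projection `P_z`, through `(1 - s_z) P_z w = (1 + s_z)⁻¹ (\bar z w) z`, which holds
because `1 - s_z² = |z|²` and needs no case distinction at `z = 0`. -/
def mobiusLin (z : E) : E →L[ℂ] E :=
  mobiusScale z • ContinuousLinearMap.id ℂ E +
    (1 + mobiusScale z)⁻¹ • (innerSL ℂ z).smulRight z

theorem mobiusLin_apply (z w : E) :
    mobiusLin z w = mobiusScale z • w + ((1 + mobiusScale z)⁻¹ * inner ℂ z w) • z := by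
  simp [mobiusLin, smul_smul]

theorem mobiusLin_self (hz : z ∈ Metric.ball 0 1) : mobiusLin z z = z := by
  have hs := one_add_mobiusScale_ne_zero z
  rw [mobiusLin_apply, ← add_smul, inner_self_eq_ofReal_norm_sq,
    show (‖z‖ : ℂ) ^ 2 = 1 - mobiusScale z ^ 2 by rw [mobiusScale_sq hz]; ring]
  convert one_smul ℂ z
  field_simp
  ring

theorem mobiusLin_symm (z a w : E) : inner ℂ (mobiusLin z a) w = inner ℂ a (mobiusLin z w) := by
  have hs : conj (mobiusScale z) = mobiusScale z := Complex.conj_ofReal _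
  simp only [mobiusLin_apply, inner_add_left, inner_add_right, inner_smul_left, inner_smul_right,
    map_mul, map_inv₀, map_add, map_one, hs, inner_conj_symm]
  ring

theorem inner_self_mobiusLin (hz : z ∈ Metric.ball 0 1) (w : E) :
    inner ℂ z (mobiusLin z w) = inner ℂ z w := by
  rw [← mobiusLin_symm, mobiusLin_self hz]

theorem mobiusLin_mobiusLin (hz : z ∈ Metric.ball 0 1) (w : E) :
    mobiusLin z (mobiusLin z w) = (1 - (‖z‖ : ℂ) ^ 2) • w + inner ℂ z w • z := by
  have hs := one_add_mobiusScale_ne_zero z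
  have hcoeff : inner ℂ z w = mobiusScale z * ((1 + mobiusScale z)⁻¹ * inner ℂ z w) +
      (1 + mobiusScale z)⁻¹ * inner ℂ z w := by
    field_simp
    ring
  rw [mobiusLin_apply z (mobiusLin z w), inner_self_mobiusLin hz, mobiusLin_apply,
    ← mobiusScale_sq hz]
  nth_rewrite 3 [hcoeff]
  module

theorem norm_mobiusLin_sq (hz : z ∈ Metric.ball 0 1) (w : E) :
    ‖mobiusLin z w‖ ^ 2 = (1 - ‖z‖ ^ 2) * ‖w‖ ^ 2 + ‖inner ℂ z w‖ ^ 2 := by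
  have h := inner_self_eq_ofReal_norm_sq (mobiusLin z w)
  rw [mobiusLin_symm, mobiusLin_mobiusLin hz, inner_add_right, inner_smul_right, inner_smul_right,
    inner_self_eq_ofReal_norm_sq, ← inner_conj_symm w z, Complex.mul_conj'] at h
  exact_mod_cast h.symm

theorem norm_sub_mobiusLin_sq (hz : z ∈ Metric.ball 0 1) (w : E) :
    ‖z - mobiusLin z w‖ ^ 2 =
      ‖1 - inner ℂ z w‖ ^ 2 - (1 - ‖z‖ ^ 2) * (1 - ‖w‖ ^ 2) := by
  have h : ‖1 - inner ℂ z w‖ ^ 2 = 1 - 2 * (inner ℂ z w : ℂ).re + ‖inner ℂ z w‖ ^ 2 := by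
    simpa using norm_sub_sq (𝕜 := ℂ) (1 : ℂ) (inner ℂ z w)
  rw [norm_sub_sq (𝕜 := ℂ), inner_self_mobiusLin hz, norm_mobiusLin_sq hz, h,
    RCLike.re_eq_complex_re]
  ring

end InnerProductSpace

section Mobius

variable {n : ℕ} {z a w : Cn n}

theorem mobius_eq (hz : z ∈ unitBall n) (w : Cn n) :
    mobius z w = (1 - inner ℂ z w)⁻¹ • (z - mobiusLin z w) := by
  have hP : ((‖z‖ : ℂ) ^ 2) • (ℂ ∙ z).starProjection w = inner ℂ z w • z := by
    simpa using Submodule.smul_starProjection_singleton (𝕜 := ℂ) (v := z) w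
  have hs := one_add_mobiusScale_ne_zero z
  have hc : 1 - mobiusScale z = (1 + mobiusScale z)⁻¹ * (‖z‖ : ℂ) ^ 2 := by
    rw [show (‖z‖ : ℂ) ^ 2 = 1 - mobiusScale z ^ 2 by rw [mobiusScale_sq hz]; ring]
    field_simp
    ring
  have hA : mobiusLin z w =
      mobiusScale z • w + (1 - mobiusScale z) • (ℂ ∙ z).starProjection w := by
    rw [mobiusLin_apply, mul_smul, ← hP, hc, mul_smul]
  rw [mobius, hA]
  change _ • (z - _ - mobiusScale z • _) = _
  module

theorem one_sub_norm_sq_mobius (hz : z ∈ unitBall n) (hw : w ∈ unitBall n) :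
    1 - ‖mobius z w‖ ^ 2 = (1 - ‖z‖ ^ 2) * (1 - ‖w‖ ^ 2) / ‖1 - inner ℂ z w‖ ^ 2 := by
  have hd : ‖1 - inner ℂ z w‖ ≠ 0 := norm_ne_zero_iff.mpr (one_sub_inner_ne_zero hz hw)
  rw [mobius_eq hz, norm_smul, norm_inv, mul_pow, inv_pow, norm_sub_mobiusLin_sq hz]
  field_simp
  ring

theorem mobius_mem_unitBall (hz : z ∈ unitBall n) (hw : w ∈ unitBall n) :
    mobius z w ∈ unitBall n := by
  have hd : 0 < ‖1 - inner ℂ z w‖ := norm_pos_iff.mpr (one_sub_inner_ne_zero hz hw)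
  have h : 0 < 1 - ‖mobius z w‖ ^ 2 := by
    rw [one_sub_norm_sq_mobius hz hw]
    exact div_pos (mul_pos (one_sub_norm_sq_pos hz) (one_sub_norm_sq_pos hw)) (pow_pos hd 2)
  rw [mem_ball_zero_iff, ← sq_lt_one_iff₀ (norm_nonneg _)]
  exact sub_pos.mp h

theorem one_sub_inner_self_mobius (hz : z ∈ unitBall n) (hw : w ∈ unitBall n) :
    1 - inner ℂ z (mobius z w) = (1 - (‖z‖ : ℂ) ^ 2) / (1 - inner ℂ z w) := by
  have hd := one_sub_inner_ne_zero hz hw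
  rw [mobius_eq hz, inner_smul_right, inner_sub_right, inner_self_mobiusLin hz,
    inner_self_eq_ofReal_norm_sq]
  field_simp
  ring

theorem mobius_mobius (hz : z ∈ unitBall n) (hw : w ∈ unitBall n) :
    mobius z (mobius z w) = w := by
  have hd := one_sub_inner_ne_zero hz hw
  have hz' : 1 - (‖z‖ : ℂ) ^ 2 ≠ 0 := by exact_mod_cast (one_sub_norm_sq_pos hz).ne'
  have hnum : z - mobiusLin z (mobius z w) =
      ((1 - (‖z‖ : ℂ) ^ 2) / (1 - inner ℂ z w)) • w := by
    have h1 : z = (1 - inner ℂ z w)⁻¹ • (1 - inner ℂ z w) • z := (inv_smul_smul₀ hd z).symm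
    rw [mobius_eq hz, map_smul, map_sub, mobiusLin_self hz, mobiusLin_mobiusLin hz, div_eq_inv_mul]
    nth_rewrite 1 [h1]
    module
  rw [mobius_eq hz (mobius z w), one_sub_inner_self_mobius hz hw, hnum,
    inv_smul_smul₀ (div_ne_zero hz' hd)]

theorem mobius_zero (hz : z ∈ unitBall n) : mobius z 0 = z := by simp [mobius_eq hz]

theorem mobius_self (hz : z ∈ unitBall n) : mobius z z = 0 := by
  simp [mobius_eq hz, mobiusLin_self hz]

theorem image_mobius_unitBall (hz : z ∈ unitBall n) : mobius z '' unitBall n = unitBall n :=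
  Set.Subset.antisymm (Set.image_subset_iff.mpr fun _ hw => mobius_mem_unitBall hz hw)
    fun w hw => ⟨mobius z w, mobius_mem_unitBall hz hw, mobius_mobius hz hw⟩

theorem injOn_mobius_unitBall (hz : z ∈ unitBall n) : Set.InjOn (mobius z) (unitBall n) :=
  Set.LeftInvOn.injOn fun _ hw => mobius_mobius hz hw

theorem one_sub_inner_mobius_mul (hz : z ∈ unitBall n) (ha : a ∈ unitBall n)
    (hw : w ∈ unitBall n) :
    (1 - inner ℂ a z) * (1 - inner ℂ (mobius z a) w) =
      (1 - inner ℂ z w) * (1 - inner ℂ a (mobius z w)) := by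
  have hd := one_sub_inner_ne_zero hz hw
  have hd' := one_sub_inner_ne_zero ha hz
  rw [mobius_eq hz, mobius_eq hz, inner_smul_left, inner_smul_right, inner_sub_left,
    inner_sub_right, mobiusLin_symm, map_inv₀, map_sub, map_one, inner_conj_symm]
  field_simp
  ring

theorem kernelFun_mul_kernelFun_mobius (hz : z ∈ unitBall n) (ha : a ∈ unitBall n)
    (hw : w ∈ unitBall n) :
    kernelFun z w * kernelFun a (mobius z w) = kernelFun a z * kernelFun (mobius z a) w := by
  simp only [kernelFun, ← mul_inv, ← mul_pow, one_sub_inner_mobius_mul hz ha hw]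

/-! ### The Jacobian of `φ_z` and the norm of `K_z` in `A²` -/

/-- The complex derivative of the Möbius involution `φ_z` at `w`. -/
def mobiusDeriv (z w : Cn n) : Cn n →L[ℂ] Cn n :=
  (1 - inner ℂ z w)⁻¹ • ((innerSL ℂ z).smulRight (mobius z w) - mobiusLin z)

theorem hasFDerivAt_mobius (hz : z ∈ unitBall n) (hw : w ∈ unitBall n) :
    HasFDerivAt (mobius z) (mobiusDeriv z w) w := by
  have hd := one_sub_inner_ne_zero hz hw
  have hdenom : HasFDerivAt (fun w => 1 - inner ℂ z w) (-(innerSL ℂ z)) w := by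
    simpa using (innerSL ℂ z).hasFDerivAt (x := w).const_sub 1
  have hnum : HasFDerivAt (fun w => z - mobiusLin z w) (-(mobiusLin z)) w :=
    (mobiusLin z).hasFDerivAt.const_sub z
  rw [funext (mobius_eq hz)]
  convert! ((hasDerivAt_inv hd).comp_hasFDerivAt w hdenom).smul hnum using 1
  ext1 v
  have hcoeff : -((1 - inner ℂ z w) ^ 2)⁻¹ * -(inner ℂ z v) =
      (1 - inner ℂ z w)⁻¹ * (inner ℂ z v * (1 - inner ℂ z w)⁻¹) := by
    field_simp
  simp only [mobiusDeriv, mobius_eq hz, Function.comp_apply, add_apply, smul_apply, sub_apply,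
    neg_apply, ContinuousLinearMap.smulRight_apply, innerSL_apply_apply, smul_eq_mul, hcoeff]
  module

theorem differentiableOn_mobius (hz : z ∈ unitBall n) :
    DifferentiableOn ℂ (mobius z) (unitBall n) := fun _ hw =>
  (hasFDerivAt_mobius hz hw).differentiableAt.differentiableWithinAt

theorem mobiusDeriv_eq_smul_transvection (hz : z ∈ unitBall n) (w : Cn n) :
    (mobiusDeriv z w).toLinearMap = (1 - inner ℂ z w)⁻¹ • -mobiusScale z •
      LinearMap.transvection (innerSL ℂ z).toLinearMap
        ((mobiusScale z)⁻¹ • ((1 + mobiusScale z)⁻¹ • z - mobius z w)) := by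
  have hs := mobiusScale_ne_zero hz
  ext1 x
  simp only [mobiusDeriv, ContinuousLinearMap.coe_coe, smul_apply, sub_apply, mobiusLin_apply,
    ContinuousLinearMap.smulRight_apply, innerSL_apply_apply, LinearMap.smul_apply,
    LinearMap.transvection.apply]
  match_scalars <;> field_simp

theorem det_mobiusDeriv (hz : z ∈ unitBall n) (hw : w ∈ unitBall n) :
    (mobiusDeriv z w).toLinearMap.det =
      (-1) ^ n * (mobiusScale z / (1 - inner ℂ z w)) ^ (n + 1) := by
  have hd := one_sub_inner_ne_zero hz hw
  have hs := mobiusScale_ne_zero hz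
  have hs' := one_add_mobiusScale_ne_zero z
  have hz2 : (‖z‖ : ℂ) ^ 2 = 1 - mobiusScale z ^ 2 := by rw [mobiusScale_sq hz]; ring
  have hinner : inner ℂ z (mobius z w) = 1 - mobiusScale z ^ 2 / (1 - inner ℂ z w) := by
    rw [mobiusScale_sq hz, ← one_sub_inner_self_mobius hz hw, sub_sub_cancel]
  rw [mobiusDeriv_eq_smul_transvection hz, LinearMap.det_smul, LinearMap.det_smul,
    LinearMap.transvection.det, finrank_euclideanSpace_fin, ContinuousLinearMap.coe_coe,
    innerSL_apply_apply, inner_smul_right, inner_sub_right, inner_smul_right,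
    inner_self_eq_ofReal_norm_sq, hz2, hinner, neg_pow, div_pow, inv_pow]
  field_simp
  ring

theorem abs_det_mobiusDeriv (hz : z ∈ unitBall n) (hw : w ∈ unitBall n) :
    |((mobiusDeriv z w).restrictScalars ℝ).det| =
      (1 - ‖z‖ ^ 2) ^ (n + 1) * ‖kernelFun z w‖ ^ 2 := by
  have hdet : ((mobiusDeriv z w).restrictScalars ℝ).det =
      ‖(mobiusDeriv z w).toLinearMap.det‖ ^ 2 := by
    have h := LinearMap.det_restrictScalars (R := ℝ) (f := (mobiusDeriv z w).toLinearMap)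
    rwa [Algebra.norm_complex_apply, Complex.normSq_eq_norm_sq] at h
  rw [hdet, abs_of_nonneg (sq_nonneg _), det_mobiusDeriv hz hw, ← norm_mobiusScale_sq hz]
  simp only [kernelFun, norm_mul, norm_pow, norm_inv, norm_neg, norm_div, norm_one, one_pow,
    one_mul]
  ring

instance isProbabilityMeasure_ballMeasure : IsProbabilityMeasure (ballMeasure n) := by
  constructor
  rw [ballMeasure, Measure.smul_apply, Measure.restrict_apply_univ, smul_eq_mul]
  exact ENNReal.inv_mul_cancel (Metric.measure_ball_pos volume (0 : Cn n) one_pos).ne'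
    measure_ball_lt_top.ne

theorem ae_mem_unitBall : ∀ᵐ w ∂(ballMeasure n), w ∈ unitBall n :=
  Measure.ae_smul_measure (ae_restrict_mem Metric.isOpen_ball.measurableSet) _

theorem lintegral_enorm_kernelFun_sq (hz : z ∈ unitBall n) :
    ∫⁻ w, ‖kernelFun z w‖ₑ ^ 2 ∂(ballMeasure n) =
      ENNReal.ofReal (((1 - ‖z‖ ^ 2) ^ (n + 1))⁻¹) := by
  have hpos : 0 < (1 - ‖z‖ ^ 2) ^ (n + 1) := pow_pos (one_sub_norm_sq_pos hz) _
  have hchange : volume (unitBall n) = ENNReal.ofReal ((1 - ‖z‖ ^ 2) ^ (n + 1)) *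
      ∫⁻ w in unitBall n, ‖kernelFun z w‖ₑ ^ 2 := by
    have h := lintegral_image_eq_lintegral_abs_det_fderiv_mul volume
      Metric.isOpen_ball.measurableSet
      (fun w hw => ((hasFDerivAt_mobius hz hw).restrictScalars ℝ).hasFDerivWithinAt)
      (injOn_mobius_unitBall hz) (fun _ => 1)
    rw [image_mobius_unitBall hz, setLIntegral_one] at h
    rw [h, ← lintegral_const_mul' _ _ ENNReal.ofReal_ne_top]
    refine setLIntegral_congr_fun Metric.isOpen_ball.measurableSet fun w hw => ?_
    beta_reduce
    rw [abs_det_mobiusDeriv hz hw, ENNReal.ofReal_mul hpos.le, mul_one,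
      ENNReal.ofReal_pow (norm_nonneg _), ofReal_norm]
  rw [ballMeasure, lintegral_smul_measure, smul_eq_mul, ENNReal.ofReal_inv_of_pos hpos]
  refine ENNReal.eq_inv_of_mul_eq_one_left ?_
  rw [mul_right_comm, mul_assoc, ← hchange]
  exact ENNReal.inv_mul_cancel (Metric.measure_ball_pos volume (0 : Cn n) one_pos).ne'
    measure_ball_lt_top.ne

theorem norm_K_two_sq (z : unitBall n) :
    ‖K 2 z‖ ^ 2 = ((1 - ‖(z : Cn n)‖ ^ 2) ^ (n + 1))⁻¹ := by
  have hpos : 0 < (1 - ‖(z : Cn n)‖ ^ 2) ^ (n + 1) := pow_pos (one_sub_norm_sq_pos z.2) _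
  have hnorm : ‖K 2 z‖ = (eLpNorm (kernelFun (z : Cn n)) 2 (ballMeasure n)).toReal :=
    Lp.norm_toLp _ (kernelFun_memLp 2 z)
  rw [hnorm, ← ENNReal.toReal_pow, eLpNorm_eq_lintegral_rpow_enorm_toReal two_ne_zero
    ENNReal.ofNat_ne_top]
  simp only [ENNReal.toReal_ofNat, ENNReal.rpow_ofNat]
  rw [lintegral_enorm_kernelFun_sq z.2, ← ENNReal.rpow_ofNat, ← ENNReal.rpow_mul]
  norm_num
  exact hpos.le

end Mobius

/-! ### The weak type estimate for the Bergman kernel -/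

section WeakType

variable {α : Type*} [MeasurableSpace α] {μ : Measure α} {f : α → ℝ} {A M q : ℝ}

theorem lintegral_Ioc_const_mul_rpow (hA : 0 ≤ A) (hM : 0 ≤ M) (hq : -1 < q) :
    ∫⁻ t in Set.Ioc 0 M, ENNReal.ofReal (A * t ^ q) =
      ENNReal.ofReal (A * (M ^ (q + 1) / (q + 1))) := by
  have hint : IntervalIntegrable (fun t : ℝ => A * t ^ q) volume 0 M :=
    (intervalIntegral.intervalIntegrable_rpow' hq).const_mul A
  rw [← ofReal_integral_eq_lintegral_ofReal
      ((intervalIntegrable_iff_integrableOn_Ioc_of_le hM).mp hint)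
      (ae_restrict_of_forall_mem measurableSet_Ioc fun t ht =>
        mul_nonneg hA (Real.rpow_nonneg ht.1.le q)),
    ← intervalIntegral.integral_of_le hM, intervalIntegral.integral_const_mul,
    integral_rpow (Or.inl hq), Real.zero_rpow (by linarith), sub_zero]

theorem lintegral_rpow_le_of_measure_lt_le (hf0 : 0 ≤ᵐ[μ] f) (hf : AEMeasurable f μ)
    (hA : 0 ≤ A) (hweak : ∀ t > 0, μ {a | t < f a} ≤ ENNReal.ofReal (A / t))
    (hM : 0 ≤ M) (hfM : ∀ᵐ a ∂μ, f a ≤ M) (hq : 1 < q) :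
    ∫⁻ a, ENNReal.ofReal (f a ^ q) ∂μ ≤ ENNReal.ofReal (q * (A * (M ^ (q - 1) / (q - 1)))) := by
  have htail : ∀ t, M < t → μ {a | t < f a} = 0 := fun t ht =>
    measure_eq_zero_iff_ae_notMem.mpr <| hfM.mono fun a ha => not_lt.mpr (ha.trans ht.le)
  have hdist : ∀ t, (Set.Ioi 0).indicator
        (fun t => μ {a | t < f a} * ENNReal.ofReal (t ^ (q - 1))) t ≤
      (Set.Ioc 0 M).indicator (fun t => ENNReal.ofReal (A * t ^ (q - 2))) t := by
    intro t
    by_cases ht : 0 < t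
    · rw [Set.indicator_of_mem (Set.mem_Ioi.mpr ht)]
      rcases le_or_gt t M with htM | htM
      · rw [Set.indicator_of_mem (Set.mem_Ioc.mpr ⟨ht, htM⟩),
          show A * t ^ (q - 2) = A / t * t ^ (q - 1) by
            rw [show q - 2 = q - 1 - 1 by ring, Real.rpow_sub_one ht.ne']; ring,
          ENNReal.ofReal_mul (by positivity)]
        gcongr
        exact hweak t ht
      · simp [htail t htM]
    · simp [Set.indicator_of_notMem (show t ∉ Set.Ioi (0 : ℝ) from ht)]
  rw [lintegral_rpow_eq_lintegral_meas_lt_mul _ hf0 hf (by linarith),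
    ENNReal.ofReal_mul (p := q) (by linarith)]
  gcongr
  refine (le_of_eq (lintegral_indicator measurableSet_Ioi _).symm).trans <|
    (lintegral_mono hdist).trans ?_
  rw [lintegral_indicator measurableSet_Ioc,
    lintegral_Ioc_const_mul_rpow hA hM (by linarith), show q - 2 + 1 = q - 1 by ring]

end WeakType

section Kernel

variable {n : ℕ} {z w : Cn n}

theorem ballMeasure_norm_one_sub_inner_lt_le_of_mem (hz : z ∈ unitBall n) {ε : ℝ} (hε : 0 < ε) :
    ballMeasure n {w | ‖1 - inner ℂ z w‖ < ε} ≤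
      ENNReal.ofReal ((ε ^ 2 / (1 - ‖z‖ ^ 2)) ^ (n + 1)) := by
  have hlevel : 0 < ((ε ^ (n + 1)) ^ 2)⁻¹ := by positivity
  have hsub : ∀ᵐ w ∂(ballMeasure n), w ∈ {w | ‖1 - inner ℂ z w‖ < ε} →
      w ∈ {w | ENNReal.ofReal (((ε ^ (n + 1)) ^ 2)⁻¹) ≤ ‖kernelFun z w‖ₑ ^ 2} := by
    filter_upwards [ae_mem_unitBall] with w hw hlt
    have hpos : 0 < ‖1 - inner ℂ z w‖ := norm_pos_iff.mpr (one_sub_inner_ne_zero hz hw)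
    change _ ≤ ‖kernelFun z w‖ₑ ^ 2
    rw [← ofReal_norm, ← ENNReal.ofReal_pow (norm_nonneg _), kernelFun,
      norm_inv, norm_pow, inv_pow]
    gcongr
  have hmeas : AEMeasurable (fun w => ‖kernelFun z w‖ₑ ^ 2) (ballMeasure n) :=
    (kernelFun_memLp 2 ⟨z, hz⟩).1.enorm.pow_const 2
  refine (measure_mono_ae hsub).trans <| (meas_ge_le_lintegral_div hmeas
    (ENNReal.ofReal_pos.mpr hlevel).ne' ENNReal.ofReal_ne_top).trans (le_of_eq ?_)
  rw [lintegral_enorm_kernelFun_sq hz, ← ENNReal.ofReal_div_of_pos hlevel, div_inv_eq_mul,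
    div_pow, div_eq_inv_mul, pow_right_comm]

/-- The sets `{w : |1 - \bar z w| < δ}` are the nonisotropic balls of the unit sphere; they
are compared with superlevel sets of the kernel `K_y` at `y = (1 - δ) z`. -/
theorem ballMeasure_norm_one_sub_inner_lt_le (hz : ‖z‖ ≤ 1) {δ : ℝ} (hδ : 0 < δ) :
    ballMeasure n {w | ‖1 - inner ℂ z w‖ < δ} ≤ ENNReal.ofReal ((4 * δ) ^ (n + 1)) := by
  rcases le_or_gt 1 δ with h1 | h1
  · refine prob_le_one.trans ?_
    rw [← ENNReal.ofReal_one]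
    exact ENNReal.ofReal_le_ofReal (one_le_pow₀ (by linarith))
  have hδ' : ‖((1 - δ : ℝ) : ℂ)‖ = 1 - δ := by
    rw [Complex.norm_real, Real.norm_of_nonneg (by linarith)]
  set y : Cn n := ((1 - δ : ℝ) : ℂ) • z
  have hy : ‖y‖ ≤ 1 - δ := by
    rw [norm_smul, hδ']
    exact mul_le_of_le_one_right (by linarith) hz
  have hy_mem : y ∈ unitBall n := mem_ball_zero_iff.mpr (by linarith)
  have hy_sq : δ ≤ 1 - ‖y‖ ^ 2 := by nlinarith [norm_nonneg y]
  have hsub : ∀ᵐ w ∂(ballMeasure n), w ∈ {w | ‖1 - inner ℂ z w‖ < δ} →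
      w ∈ {w | ‖1 - inner ℂ y w‖ < 2 * δ} := by
    filter_upwards [ae_mem_unitBall] with w hw hlt
    have hinner : ‖inner ℂ z w‖ ≤ 1 := (norm_inner_le_norm z w).trans <|
      mul_le_one₀ hz (norm_nonneg w) (mem_ball_zero_iff.mp hw).le
    have hsplit : 1 - inner ℂ y w = (1 - inner ℂ z w) + ((δ : ℝ) : ℂ) * inner ℂ z w := by
      rw [inner_smul_left, Complex.conj_ofReal]
      push_cast
      ring
    have hδ_inner : ‖((δ : ℝ) : ℂ) * inner ℂ z w‖ ≤ δ := by
      rw [norm_mul, Complex.norm_real, Real.norm_of_nonneg hδ.le]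
      exact mul_le_of_le_one_right hδ.le hinner
    change ‖1 - inner ℂ z w‖ < δ at hlt
    change ‖1 - inner ℂ y w‖ < 2 * δ
    rw [hsplit]
    linarith [norm_add_le (1 - inner ℂ z w) (((δ : ℝ) : ℂ) * inner ℂ z w)]
  refine (measure_mono_ae hsub).trans <|
    (ballMeasure_norm_one_sub_inner_lt_le_of_mem hy_mem (by linarith)).trans ?_
  gcongr
  · exact div_nonneg (by positivity) (by linarith)
  · rw [div_le_iff₀ (by linarith)]
    nlinarith

theorem ballMeasure_lt_norm_kernelFun_le (hz : z ∈ unitBall n) {t : ℝ} (ht : 0 < t) :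
    ballMeasure n {w | t < ‖kernelFun z w‖} ≤ ENNReal.ofReal (4 ^ (n + 1) / t) := by
  set δ : ℝ := t⁻¹ ^ (((n + 1 : ℕ) : ℝ)⁻¹)
  have hδ : 0 < δ := by positivity
  have hδ_pow : δ ^ (n + 1) = t⁻¹ := Real.rpow_inv_natCast_pow (by positivity) n.succ_ne_zero
  rw [div_eq_mul_inv, ← hδ_pow, ← mul_pow]
  refine (measure_mono_ae ?_).trans
    (ballMeasure_norm_one_sub_inner_lt_le (mem_ball_zero_iff.mp hz).le hδ)
  filter_upwards [ae_mem_unitBall] with w hw hlt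
  have hpos : 0 < ‖1 - inner ℂ z w‖ := norm_pos_iff.mpr (one_sub_inner_ne_zero hz hw)
  replace hlt : t < (‖1 - inner ℂ z w‖ ^ (n + 1))⁻¹ := by
    rw [← norm_pow, ← norm_inv]
    exact hlt
  refine lt_of_pow_lt_pow_left₀ (n + 1) hδ.le ?_
  rw [hδ_pow]
  exact (lt_inv_comm₀ ht (by positivity)).mp hlt

theorem norm_kernelFun_le (hz : z ∈ unitBall n) (hw : w ∈ unitBall n) :
    ‖kernelFun z w‖ ≤ ((1 - ‖z‖) ^ (n + 1))⁻¹ := by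
  have h0 := one_sub_norm_pos hz
  rw [kernelFun, norm_inv, norm_pow]
  gcongr
  exact one_sub_norm_le z hw

theorem norm_K_le {p : ℝ≥0∞} [Fact (1 ≤ p)] (hp : 1 < p.toReal) (z : unitBall n) :
    ‖K p z‖ ≤ (p.toReal / (p.toReal - 1) * 4 ^ (n + 1)) ^ p.toReal⁻¹ *
      (((1 - ‖(z : Cn n)‖) ^ (n + 1))⁻¹) ^ (1 - p.toReal⁻¹) := by
  have hp_top : p ≠ ∞ := by
    rintro rfl
    exact absurd hp (by simp)
  have hq1 : 0 < p.toReal - 1 := by linarith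
  have hz := one_sub_norm_pos z.2
  set M : ℝ := ((1 - ‖(z : Cn n)‖) ^ (n + 1))⁻¹
  have hM : 0 < M := by positivity
  have hnorm : ‖K p z‖ = (eLpNorm (kernelFun (z : Cn n)) p (ballMeasure n)).toReal :=
    Lp.norm_toLp _ (kernelFun_memLp p z)
  have hint : ∫⁻ w, ‖kernelFun (z : Cn n) w‖ₑ ^ p.toReal ∂(ballMeasure n) ≤
      ENNReal.ofReal (p.toReal / (p.toReal - 1) * 4 ^ (n + 1) * M ^ (p.toReal - 1)) := by
    simp only [← ofReal_norm, ENNReal.ofReal_rpow_of_nonneg (norm_nonneg _)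
      (zero_le_one.trans hp.le)]
    refine (lintegral_rpow_le_of_measure_lt_le (ae_of_all _ fun w => norm_nonneg _)
      (kernelFun_memLp p z).1.norm.aemeasurable (by positivity)
      (fun t ht => ballMeasure_lt_norm_kernelFun_le z.2 ht) hM.le
      (ae_mem_unitBall.mono fun w hw => norm_kernelFun_le z.2 hw) hp).trans_eq ?_
    congr 1
    ring
  rw [hnorm, eLpNorm_eq_lintegral_rpow_enorm_toReal
    (zero_lt_one.trans_le (Fact.out : 1 ≤ p)).ne' hp_top]
  refine ENNReal.toReal_le_of_le_ofReal (by positivity)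
    ((ENNReal.rpow_le_rpow hint (by positivity)).trans_eq ?_)
  rw [one_div, ENNReal.ofReal_rpow_of_nonneg (by positivity) (by positivity),
    Real.mul_rpow (by positivity) (by positivity), ← Real.rpow_mul hM.le]
  congr 3
  field_simp

theorem norm_K_two_rpow_two_div (z : unitBall n) (s : ℝ) :
    ‖K 2 z‖ ^ (2 / s) = (((1 - ‖(z : Cn n)‖ ^ 2) ^ (n + 1))⁻¹) ^ s⁻¹ := by
  rw [← norm_K_two_sq, ← Real.rpow_natCast, ← Real.rpow_mul (norm_nonneg _), div_eq_mul_inv,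
    Nat.cast_ofNat]

theorem norm_kNorm {p : ℝ≥0∞} [Fact (1 ≤ p)] (p' : ℝ≥0∞) (z : unitBall n) :
    ‖kNorm p p' z‖ =
      ((((1 - ‖(z : Cn n)‖ ^ 2) ^ (n + 1))⁻¹) ^ p'.toReal⁻¹)⁻¹ * ‖K p z‖ := by
  have h := pow_nonneg (one_sub_norm_sq_pos z.2).le (n + 1)
  rw [kNorm, norm_smul, Complex.norm_real, norm_K_two_rpow_two_div,
    Real.norm_of_nonneg (by positivity)]

theorem holderConjugate_toReal (p p' : ℝ≥0∞) [p.HolderConjugate p'] (hp : 1 < p)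
    (hp' : 1 < p') : p.toReal.HolderConjugate p'.toReal :=
  ENNReal.HolderConjugate.toReal_of_ne_top
    ((ENNReal.HolderConjugate.ne_top_iff_ne_one p p').mpr hp'.ne')
    ((ENNReal.HolderConjugate.ne_top_iff_ne_one p' p).mpr hp.ne')

theorem exists_norm_kNorm_le (n : ℕ) (p p' : ℝ≥0∞) [Fact (1 ≤ p)] [p.HolderConjugate p']
    (hp : 1 < p) (hp' : 1 < p') : ∃ C, ∀ z : unitBall n, ‖kNorm p p' z‖ ≤ C := by
  have hconj := holderConjugate_toReal p p' hp hp'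
  have hC : 0 ≤ p.toReal / (p.toReal - 1) :=
    div_nonneg hconj.nonneg (sub_nonneg.mpr hconj.lt.le)
  refine ⟨(p.toReal / (p.toReal - 1) * 4 ^ (n + 1)) ^ p.toReal⁻¹ *
    (2 ^ (n + 1)) ^ p'.toReal⁻¹, fun z => ?_⟩
  have hz := one_sub_norm_pos z.2
  have hz_sq := one_sub_norm_sq_pos z.2
  set X : ℝ := ((1 - ‖(z : Cn n)‖ ^ 2) ^ (n + 1))⁻¹
  have hX : 0 < X := by positivity
  have hcompare : ((1 - ‖(z : Cn n)‖) ^ (n + 1))⁻¹ ≤ 2 ^ (n + 1) * X := by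
    rw [← inv_pow, show X = (1 - ‖(z : Cn n)‖ ^ 2)⁻¹ ^ (n + 1) from (inv_pow _ _).symm, ← mul_pow]
    gcongr
    rw [← div_eq_mul_inv, inv_le_comm₀ hz (by positivity), inv_div, div_le_iff₀ two_pos]
    nlinarith [norm_nonneg (z : Cn n)]
  calc ‖kNorm p p' z‖ = (X ^ p'.toReal⁻¹)⁻¹ * ‖K p z‖ := norm_kNorm p' z
    _ ≤ (X ^ p'.toReal⁻¹)⁻¹ * ((p.toReal / (p.toReal - 1) * 4 ^ (n + 1)) ^ p.toReal⁻¹ *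
          (2 ^ (n + 1) * X) ^ p'.toReal⁻¹) := by
      gcongr
      refine (norm_K_le hconj.lt z).trans ?_
      rw [hconj.one_sub_inv]
      gcongr
    _ = _ := by
      rw [Real.mul_rpow (by positivity) hX.le]
      field_simp

end Kernel

/-! ### Double power series in a complex variable and its conjugate -/

section DoublePowerSeries

open Real (circleAverage)

theorem circleAverage_conj_pow_mul_pow (r : ℝ) (a b : ℕ) :
    circleAverage (fun x => conj x ^ a * x ^ b) 0 r = if b = a then (r : ℂ) ^ (2 * a) else 0 := by
  have hle : ∀ a c : ℕ, circleAverage (fun x => conj x ^ a * x ^ (a + c)) 0 r =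
      (r : ℂ) ^ (2 * a) * 0 ^ c := by
    intro a c
    have hcircle : Set.EqOn (fun x => conj x ^ a * x ^ (a + c)) (fun x => (r : ℂ) ^ (2 * a) * x ^ c)
        (Metric.sphere 0 |r|) := by
      intro x hx
      have hx2 : (‖x‖ : ℂ) ^ 2 = (r : ℂ) ^ 2 := by
        rw [mem_sphere_zero_iff_norm.mp hx]
        exact_mod_cast sq_abs r
      beta_reduce
      rw [pow_add, ← mul_assoc, ← mul_pow, Complex.conj_mul', hx2, pow_mul]
    rw [Real.circleAverage_congr_sphere hcircle]
    exact DiffContOnCl.circleAverage (Differentiable.diffContOnCl (by fun_prop))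
  rcases le_total a b with h | h
  · obtain ⟨c, rfl⟩ := Nat.exists_eq_add_of_le h
    rw [hle]
    rcases c with _ | c <;> simp
  · obtain ⟨c, rfl⟩ := Nat.exists_eq_add_of_le h
    have hconj : (fun x : ℂ => conj x ^ (b + c) * x ^ b) =
        fun x => Complex.conjCLE (conj x ^ b * x ^ (b + c)) := by
      ext x
      simp [mul_comm]
    have hcomm := (Complex.conjCLE : ℂ →L[ℝ] ℂ).circleAverage_comp_comm
      (f := fun x => conj x ^ b * x ^ (b + c)) (c := 0) (R := r)
      (Continuous.intervalIntegrable (by fun_prop) _ _)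
    rw [hconj]
    refine hcomm.trans ?_
    rw [hle]
    rcases c with _ | c <;> simp

variable {d : ℕ × ℕ → ℂ} {r R ε : ℝ}

theorem norm_conj_pow_mul_pow_le (x : ℂ) (hx : ‖x‖ ≤ 1) (a b : ℕ) : ‖conj x ^ a * x ^ b‖ ≤ 1 := by
  rw [norm_mul, norm_pow, norm_pow, RCLike.norm_conj]
  exact mul_le_one₀ (pow_le_one₀ (norm_nonneg x) hx) (by positivity)
    (pow_le_one₀ (norm_nonneg x) hx)

theorem norm_circleAverage_le {f : ℂ → ℂ} {c : ℂ} {C : ℝ}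
    (h : ∀ x ∈ Metric.sphere c |r|, ‖f x‖ ≤ C) :
    ‖circleAverage f c r‖ ≤ C := by
  rw [Real.circleAverage_def, norm_smul, Real.norm_of_nonneg (by positivity),
    inv_mul_le_iff₀ Real.two_pi_pos]
  have hint := intervalIntegral.norm_integral_le_of_norm_le_const (a := 0) (b := 2 * Real.pi)
    fun θ _ => h _ (circleMap_mem_sphere' c r θ)
  rwa [sub_zero, abs_of_pos Real.two_pi_pos, mul_comm C] at hint

theorem hasSum_circleAverage_conj_pow_mul (hd : Summable fun q => ‖d q‖) (hr : 0 ≤ r)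
    (hr1 : r ≤ 1) (m : ℕ) :
    HasSum (fun j => d (j, j + m) * (r : ℂ) ^ (2 * (j + m)))
      (circleAverage (fun x => conj x ^ m * ∑' q, d q * (conj x ^ q.1 * x ^ q.2)) 0 r) := by
  have hcircle : ∀ θ, ‖circleMap 0 r θ‖ ≤ 1 := fun θ => by
    rwa [norm_circleMap_zero, abs_of_nonneg hr]
  have hbound : ∀ (q : ℕ × ℕ) (x : ℂ), ‖x‖ ≤ 1 →
      ‖d q * (conj x ^ q.1 * x ^ q.2)‖ ≤ ‖d q‖ := fun q x hx => by
    rw [norm_mul]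
    exact mul_le_of_le_one_right (norm_nonneg _) (norm_conj_pow_mul_pow_le x hx _ _)
  have hsum : HasSum
      (fun q : ℕ × ℕ => circleAverage (fun x => conj x ^ m * (d q * (conj x ^ q.1 * x ^ q.2))) 0 r)
      (circleAverage (fun x => conj x ^ m * ∑' q, d q * (conj x ^ q.1 * x ^ q.2)) 0 r) := by
    simp only [Real.circleAverage_def]
    refine HasSum.const_smul _ <| intervalIntegral.hasSum_integral_of_dominated_convergence
      (fun q _ => ‖d q‖) (fun q => Continuous.aestronglyMeasurable (by fun_prop))
      (fun q => ae_of_all _ fun θ _ => ?_) (ae_of_all _ fun θ _ => hd) intervalIntegrable_const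
      (ae_of_all _ fun θ _ =>
        (hd.of_norm_bounded fun q => hbound q _ (hcircle θ)).hasSum.mul_left _)
    rw [norm_mul, norm_pow, RCLike.norm_conj]
    exact (mul_le_of_le_one_left (norm_nonneg _)
      (pow_le_one₀ (norm_nonneg _) (hcircle θ))).trans (hbound q _ (hcircle θ))
  have hterm : ∀ q : ℕ × ℕ,
      circleAverage (fun x => conj x ^ m * (d q * (conj x ^ q.1 * x ^ q.2))) 0 r =
        if q.2 = q.1 + m then d q * (r : ℂ) ^ (2 * (q.1 + m)) else 0 := fun q => by
    have hcongr : (fun x => conj x ^ m * (d q * (conj x ^ q.1 * x ^ q.2))) =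
        fun x => d q • (conj x ^ (q.1 + m) * x ^ q.2) := by
      ext x
      rw [smul_eq_mul, pow_add]
      ring
    rw [hcongr, Real.circleAverage_fun_smul, circleAverage_conj_pow_mul_pow, smul_eq_mul, mul_ite,
      mul_zero]
  have hinj : Function.Injective fun j : ℕ => (j, j + m) := fun i j h => congrArg Prod.fst h
  simp only [hterm] at hsum
  rw [← hinj.hasSum_iff (fun q hq => if_neg fun h => hq ⟨q.1, Prod.ext rfl h.symm⟩)] at hsum
  simpa [Function.comp_def] using hsum

theorem norm_coeff_zero_le (hd : Summable fun q => ‖d q‖) (hr : 0 < r) (hr1 : r ≤ 1)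
    (h : ∀ x : ℂ, ‖x‖ = r → ‖∑' q, d q * (conj x ^ q.1 * x ^ q.2)‖ ≤ ε) (m : ℕ) :
    ‖d (0, m)‖ * r ^ m ≤ ε + r ^ (m + 2) * ∑' q, ‖d q‖ := by
  have hinj : Function.Injective fun j : ℕ => (j + 1, j + 1 + m) := fun i j h => by
    simpa using congrArg Prod.fst h
  have havg : ‖circleAverage (fun x => conj x ^ m * ∑' q, d q * (conj x ^ q.1 * x ^ q.2)) 0 r‖ ≤
      r ^ m * ε := norm_circleAverage_le fun x hx => by
    rw [abs_of_pos hr, mem_sphere_zero_iff_norm] at hx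
    rw [norm_mul, norm_pow, RCLike.norm_conj, hx]
    gcongr
    exact h x hx
  have hdiag := hasSum_circleAverage_conj_pow_mul hd hr.le hr1 m
  have htail : ‖∑' j, d (j + 1, j + 1 + m) * (r : ℂ) ^ (2 * (j + 1 + m))‖ ≤
      r ^ (2 * m + 2) * ∑' q, ‖d q‖ := by
    have hsub : Summable fun j => ‖d (j + 1, j + 1 + m)‖ := hd.comp_injective hinj
    refine (tsum_of_norm_bounded (hsub.mul_left (r ^ (2 * m + 2))).hasSum fun j => ?_).trans ?_
    · rw [norm_mul, norm_pow, Complex.norm_real, Real.norm_of_nonneg hr.le, mul_comm]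
      gcongr ?_ * _
      exact pow_le_pow_of_le_one hr.le hr1 (by omega)
    · rw [tsum_mul_left]
      gcongr
      exact tsum_comp_le_tsum_of_inj hd (fun q => norm_nonneg _) hinj
  have hsplit := hdiag.summable.tsum_eq_zero_add
  rw [hdiag.tsum_eq, zero_add] at hsplit
  have hzero : ‖d (0, m)‖ * r ^ (2 * m) ≤ r ^ m * ε + r ^ (2 * m + 2) * ∑' q, ‖d q‖ := by
    calc ‖d (0, m)‖ * r ^ (2 * m) = ‖d (0, m) * (r : ℂ) ^ (2 * m)‖ := by
          rw [norm_mul, norm_pow, Complex.norm_real, Real.norm_of_nonneg hr.le]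
      _ ≤ _ := by
          rw [eq_sub_iff_add_eq.mpr hsplit.symm]
          exact (norm_sub_le _ _).trans (add_le_add havg htail)
  refine le_of_mul_le_mul_left (hzero.trans_eq' ?_ |>.trans_eq ?_) (pow_pos hr m) <;> ring

variable {ι : Type*} {l : Filter ι} {d : ι → ℕ × ℕ → ℂ} {B : ℕ × ℕ → ℝ}

theorem tendsto_coeff_zero (hB : Summable B) (hdB : ∀ i q, ‖d i q‖ ≤ B q) (hR : 0 < R)
    (hsmall : ∀ ε > 0, ∀ᶠ i in l, ∀ x : ℂ, ‖x‖ ≤ R →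
      ‖∑' q, d i q * (conj x ^ q.1 * x ^ q.2)‖ ≤ ε) (m : ℕ) :
    Tendsto (fun i => d i (0, m)) l (𝓝 0) := by
  rw [Metric.tendsto_nhds]
  intro η hη
  have hlim : Tendsto (fun r : ℝ => r ^ 2 * ∑' q, B q) (𝓝[>] 0) (𝓝 0) :=
    (Continuous.tendsto' (by fun_prop) 0 0 (by simp)).mono_left nhdsWithin_le_nhds
  obtain ⟨r, hrη, hr0, hrR⟩ := ((hlim.eventually (gt_mem_nhds (half_pos hη))).and
    (Ioc_mem_nhdsGT (lt_min hR one_pos))).exists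
  filter_upwards [hsmall (r ^ m * (η / 4)) (by positivity)] with i hi
  have hd : Summable fun q => ‖d i q‖ := hB.of_nonneg_of_le (fun q => norm_nonneg _) (hdB i)
  have hcoeff := norm_coeff_zero_le hd hr0 (hrR.trans (min_le_right _ _))
    (fun x hx => hi x (hx.trans_le (hrR.trans (min_le_left _ _)))) m
  have hle : ‖d i (0, m)‖ * r ^ m ≤ (η / 4 + r ^ 2 * ∑' q, B q) * r ^ m := by
    calc ‖d i (0, m)‖ * r ^ m ≤ r ^ m * (η / 4) + r ^ (m + 2) * ∑' q, ‖d i q‖ := hcoeff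
      _ ≤ r ^ m * (η / 4) + r ^ (m + 2) * ∑' q, B q := by
        gcongr _ + _ * ?_
        exact hd.tsum_le_tsum (hdB i) hB
      _ = _ := by ring
  rw [dist_zero_right]
  linarith [le_of_mul_le_mul_right hle (pow_pos hr0 m)]

theorem tendsto_tsum_coeff_zero (hB : Summable B) (hdB : ∀ i q, ‖d i q‖ ≤ B q) (hR : 0 < R)
    (hsmall : ∀ ε > 0, ∀ᶠ i in l, ∀ x : ℂ, ‖x‖ ≤ R →
      ‖∑' q, d i q * (conj x ^ q.1 * x ^ q.2)‖ ≤ ε) :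
    Tendsto (fun i => ∑' m, d i (0, m)) l (𝓝 0) := by
  have h := tendsto_tsum_of_dominated_convergence
    (hB.comp_injective (Prod.mk_right_injective (0 : ℕ)))
    (tendsto_coeff_zero hB hdB hR hsmall) (Eventually.of_forall fun i m => hdB i (0, m))
  rwa [tsum_zero] at h

end DoublePowerSeries

/-! ### Bounded holomorphic functions in the Bergman space -/

section BoundedHolomorphic

variable {n : ℕ}

/-- The space of bounded holomorphic functions on the unit ball. Its elements are functions on all
of `ℂⁿ`, of which only the values on the ball are meaningful. -/
def boundedHolomorphic (n : ℕ) : Submodule ℂ (Cn n → ℂ) where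
  carrier := {g | DifferentiableOn ℂ g (unitBall n) ∧ ∃ C : ℝ, ∀ w ∈ unitBall n, ‖g w‖ ≤ C}
  add_mem' := by
    rintro f g ⟨hf, A, hA⟩ ⟨hg, B, hB⟩
    exact ⟨hf.add hg, A + B, fun w hw => norm_add_le_of_le (hA w hw) (hB w hw)⟩
  zero_mem' := ⟨differentiableOn_const 0, 0, fun w _ => norm_zero.le⟩
  smul_mem' := by
    rintro c f ⟨hf, A, hA⟩
    exact ⟨hf.const_smul c, ‖c‖ * A, fun w hw =>
      (norm_smul_le c (f w)).trans (mul_le_mul_of_nonneg_left (hA w hw) (norm_nonneg c))⟩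

theorem memLp_of_mem_boundedHolomorphic (p : ℝ≥0∞) (g : boundedHolomorphic n) :
    MemLp (g : Cn n → ℂ) p (ballMeasure n) := by
  obtain ⟨hg, C, hC⟩ := g.2
  exact MemLp.of_bound
    ((hg.continuousOn.aestronglyMeasurable Metric.isOpen_ball.measurableSet).smul_measure _) C
    (ae_mem_unitBall.mono hC)

/-- The inclusion of the bounded holomorphic functions into `A^p`. -/
def toAp (p : ℝ≥0∞) : boundedHolomorphic n →ₗ[ℂ] Ap n p where
  toFun g := ⟨(memLp_of_mem_boundedHolomorphic p g).toLp _, g, g.2.1,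
    (memLp_of_mem_boundedHolomorphic p g).coeFn_toLp⟩
  map_add' _ _ := rfl
  map_smul' _ _ := rfl

variable {p : ℝ≥0∞}

theorem coeFn_toAp (g : boundedHolomorphic n) :
    (toAp p g : Lp ℂ p (ballMeasure n)) =ᵐ[ballMeasure n] (g : Cn n → ℂ) :=
  (memLp_of_mem_boundedHolomorphic p g).coeFn_toLp

/-- The Bergman kernel `K_z` as a bounded holomorphic function. -/
def kernelBdd (z : unitBall n) : boundedHolomorphic n :=
  ⟨kernelFun (z : Cn n), kernelFun_differentiableOn z, _, fun _ hw => norm_kernelFun_le z.2 hw⟩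

theorem toAp_kernelBdd (z : unitBall n) : toAp p (kernelBdd z) = K p z := rfl

variable [Fact (1 ≤ p)]

theorem norm_toAp_le (g : boundedHolomorphic n) {C : ℝ} (hC : 0 ≤ C)
    (h : ∀ w ∈ unitBall n, ‖(g : Cn n → ℂ) w‖ ≤ C) : ‖toAp p g‖ ≤ C := by
  have hae : ∀ᵐ w ∂ballMeasure n, ‖(toAp p g : Lp ℂ p (ballMeasure n)) w‖ ≤ C := by
    filter_upwards [coeFn_toAp g, ae_mem_unitBall] with w hg hw
    exact hg ▸ h w hw
  simpa [measureUnivNNReal] using Lp.norm_le_of_ae_bound hC hae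

theorem norm_toAp_le_norm_toAp (f g : boundedHolomorphic n)
    (h : ∀ w ∈ unitBall n, ‖(f : Cn n → ℂ) w‖ ≤ ‖(g : Cn n → ℂ) w‖) :
    ‖toAp p f‖ ≤ ‖toAp p g‖ := by
  refine Lp.norm_le_norm_of_ae_le ?_
  filter_upwards [coeFn_toAp (p := p) f, coeFn_toAp (p := p) g, ae_mem_unitBall] with w hf hg hw
  exact hf ▸ hg ▸ h w hw

theorem hasSum_toAp {ι : Type*} {g : ι → boundedHolomorphic n} {f : boundedHolomorphic n}
    {B : ι → ℝ} (hB : Summable B) (hg : ∀ j, ∀ w ∈ unitBall n, ‖(g j : Cn n → ℂ) w‖ ≤ B j)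
    (hf : ∀ w ∈ unitBall n, HasSum (fun j => (g j : Cn n → ℂ) w) ((f : Cn n → ℂ) w)) :
    HasSum (fun j => toAp p (g j)) (toAp p f) := by
  rw [HasSum, SummationFilter.unconditional_filter, Metric.tendsto_nhds]
  intro ε hε
  filter_upwards [Metric.tendstoUniformlyOn_iff.mp (tendstoUniformlyOn_tsum hB hg) (ε / 2)
    (half_pos hε)] with s hs
  rw [dist_eq_norm, ← map_sum, ← map_sub]
  refine (norm_toAp_le _ (half_pos hε).le fun w hw => ?_).trans_lt (half_lt_self hε)
  have hdist := (hs w hw).le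
  rw [(hf w hw).tsum_eq, dist_comm, dist_eq_norm] at hdist
  simpa using hdist

/-- The Möbius involution `φ_z` as a self-map of the unit ball. -/
def mobiusBall (z w : unitBall n) : unitBall n := ⟨mobius z w, mobius_mem_unitBall z.2 w.2⟩

theorem mobiusBall_mobiusBall (z w : unitBall n) : mobiusBall z (mobiusBall z w) = w :=
  Subtype.ext (mobius_mobius z.2 w.2)

/-! ### The expansion of `K_z · (K_a ∘ φ_z)` in powers of `⟨a, φ_z⟩` -/

/-- The function `K_z · (K_a ∘ φ_z)`, encoded as the multiple `K_a(z) K_{φ_z(a)}` of a kernel that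
it equals on the ball. -/
def kernelTransform (z a : unitBall n) : boundedHolomorphic n :=
  kernelFun (a : Cn n) z • kernelBdd (mobiusBall z a)

theorem kernelTransform_apply (z a : unitBall n) {w : Cn n} (hw : w ∈ unitBall n) :
    (kernelTransform z a : Cn n → ℂ) w =
      kernelFun (z : Cn n) w * kernelFun (a : Cn n) (mobius z w) :=
  (kernelFun_mul_kernelFun_mobius z.2 a.2 hw).symm

theorem norm_inner_mobius_le (z a : unitBall n) {w : Cn n} (hw : w ∈ unitBall n) :
    ‖inner ℂ (a : Cn n) (mobius z w)‖ ≤ ‖(a : Cn n)‖ :=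
  (norm_inner_le_norm _ _).trans <| mul_le_of_le_one_right (norm_nonneg _)
    (mem_ball_zero_iff.mp (mobius_mem_unitBall z.2 hw)).le

theorem norm_choose_mul_kernelFun_le (z a : unitBall n) (j : ℕ) {w : Cn n} (hw : w ∈ unitBall n) :
    ‖((j + n).choose n : ℂ) * (kernelFun (z : Cn n) w * inner ℂ (a : Cn n) (mobius z w) ^ j)‖ ≤
      (j + n).choose n * ‖(a : Cn n)‖ ^ j * ‖kernelFun (z : Cn n) w‖ := by
  rw [norm_mul, norm_mul, norm_pow, Complex.norm_natCast, mul_assoc, mul_comm ‖kernelFun _ _‖]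
  gcongr
  exact norm_inner_mobius_le z a hw

/-- The `j`-th term of the binomial expansion of `K_z · (K_a ∘ φ_z)` in powers of `⟨a, φ_z⟩`. -/
def kernelTerm (z a : unitBall n) (j : ℕ) : boundedHolomorphic n :=
  ⟨fun w => ((j + n).choose n : ℂ) *
      (kernelFun (z : Cn n) w * inner ℂ (a : Cn n) (mobius z w) ^ j),
    ((kernelFun_differentiableOn z).mul
      (((innerSL ℂ (a : Cn n)).differentiable.comp_differentiableOn
        (differentiableOn_mobius z.2)).pow j)).const_mul _,
    (j + n).choose n * ‖(a : Cn n)‖ ^ j * ((1 - ‖(z : Cn n)‖) ^ (n + 1))⁻¹, fun w hw => by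
      refine (norm_choose_mul_kernelFun_le z a j hw).trans ?_
      gcongr
      exact norm_kernelFun_le z.2 hw⟩

theorem kernelTerm_zero (z a : unitBall n) : kernelTerm z a 0 = kernelBdd z :=
  Subtype.ext <| funext fun w => by simp [kernelTerm, kernelBdd]

theorem kernelTerm_smul (z a : unitBall n) (x : Metric.closedBall (0 : ℂ) 1) (j : ℕ) :
    kernelTerm z (x • a) j = conj (x : ℂ) ^ j • kernelTerm z a j := by
  refine Subtype.ext <| funext fun w => ?_
  change _ * (_ * inner ℂ ((x : ℂ) • (a : Cn n)) _ ^ j) = _ * (_ * (_ * _ ^ j))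
  rw [inner_smul_left, mul_pow]
  ring

theorem norm_toAp_kernelTerm_le (z a : unitBall n) (j : ℕ) :
    ‖toAp p (kernelTerm z a j)‖ ≤ (j + n).choose n * ‖(a : Cn n)‖ ^ j * ‖K p z‖ := by
  have hle := norm_toAp_le_norm_toAp (p := p) (kernelTerm z a j)
    ((((j + n).choose n * ‖(a : Cn n)‖ ^ j : ℝ) : ℂ) • kernelBdd z) fun w hw => by
      refine (norm_choose_mul_kernelFun_le z a j hw).trans_eq ?_
      rw [Submodule.coe_smul, Pi.smul_apply, norm_smul, Complex.norm_real,
        Real.norm_of_nonneg (by positivity)]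
      rfl
  rwa [map_smul, norm_smul, Complex.norm_real, Real.norm_of_nonneg (by positivity),
    toAp_kernelBdd] at hle

theorem summable_choose_mul_pow (n : ℕ) {r : ℝ} (h0 : 0 ≤ r) (h1 : r < 1) :
    Summable fun j : ℕ => ((j + n).choose n : ℝ) * r ^ j :=
  summable_choose_mul_geometric_of_norm_lt_one n (by rwa [Real.norm_of_nonneg h0])

theorem summable_norm_toAp_kernelTerm (z a : unitBall n) :
    Summable fun j => ‖toAp p (kernelTerm z a j)‖ :=
  ((summable_choose_mul_pow n (norm_nonneg _) (mem_ball_zero_iff.mp a.2)).mul_right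
    ‖K p z‖).of_nonneg_of_le (fun _ => norm_nonneg _) (norm_toAp_kernelTerm_le z a)

theorem hasSum_kernelTerm (z a : unitBall n) :
    HasSum (fun j => toAp p (kernelTerm z a j)) (toAp p (kernelTransform z a)) := by
  have ha : ‖(a : Cn n)‖ < 1 := mem_ball_zero_iff.mp a.2
  refine hasSum_toAp ((summable_choose_mul_pow n (norm_nonneg _) ha).mul_right
    ((1 - ‖(z : Cn n)‖) ^ (n + 1))⁻¹) (fun j w hw => ?_) fun w hw => ?_
  · refine (norm_choose_mul_kernelFun_le z a j hw).trans ?_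
    gcongr
    exact norm_kernelFun_le z.2 hw
  · have hgeom := (hasSum_choose_mul_geometric_of_norm_lt_one n
      ((norm_inner_mobius_le z a hw).trans_lt ha)).mul_left (kernelFun (z : Cn n) w)
    rw [one_div] at hgeom
    rw [kernelTransform_apply z a hw]
    exact hgeom.congr_fun fun j => mul_left_comm _ _ _

end BoundedHolomorphic

/-! ### The pairing as a continuous sesquilinear form -/

section Pairing

variable {𝕜 E F G : Type*} [RCLike 𝕜] [NormedAddCommGroup E] [NormedSpace 𝕜 E]
  [NormedAddCommGroup F] [NormedSpace 𝕜 F] [NormedAddCommGroup G] [NormedSpace 𝕜 G]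
  [CompleteSpace G]

theorem hasSum_sesqForm (B : E →L[𝕜] F →L⋆[𝕜] G) {ι κ : Type*} {x : ι → E} {y : κ → F} {X : E}
    {Y : F} (hx : HasSum x X) (hy : HasSum y Y) (hx' : Summable fun i => ‖x i‖)
    (hy' : Summable fun j => ‖y j‖) :
    HasSum (fun q : ι × κ => B (x q.1) (y q.2)) (B X Y) := by
  have hs : Summable fun q : ι × κ => B (x q.1) (y q.2) :=
    .of_norm_bounded ((hx'.mul_of_nonneg hy' (fun _ => norm_nonneg _)
      fun _ => norm_nonneg _).mul_left ‖B‖) fun q => by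
        simpa only [mul_assoc] using B.le_opNorm₂ (x q.1) (y q.2)
  have hrows := hs.hasSum.prod_fiberwise fun i => (B (x i)).hasSum hy
  exact hrows.unique ((B.flip Y).hasSum hx) ▸ hs.hasSum

variable {n : ℕ} (p p' : ℝ≥0∞) [Fact (1 ≤ p)] [Fact (1 ≤ p')] [p.HolderConjugate p']

/-- Complex conjugation on `L^p` of the ball. -/
def conjLp (n : ℕ) : Lp ℂ p (ballMeasure n) →L⋆[ℂ] Lp ℂ p (ballMeasure n) :=
  ((starL ℂ : ℂ ≃L⋆[ℂ] ℂ) : ℂ →L⋆[ℂ] ℂ).compLpL p (ballMeasure n)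

/-- The pairing `⟨f, g⟩_{A²}` as a continuous sesquilinear form on `A^p × A^{p'}`. -/
def pairingL (n : ℕ) : Ap n p →L[ℂ] Ap n p' →L⋆[ℂ] ℂ :=
  ((ContinuousLinearMap.mul ℂ ℂ).lpPairing (ballMeasure n) p p').bilinearComp
    (Ap n p).subtypeL ((conjLp p' n).comp (Ap n p').subtypeL)

variable {p p'}

theorem norm_pairing_le (f : Ap n p) (g : Ap n p') : ‖pairing f g‖ ≤ ‖f‖ * ‖g‖ := by
  have hholder : ‖pairing f g‖ₑ ≤
      ‖(f : Lp ℂ p (ballMeasure n))‖ₑ * ‖(g : Lp ℂ p' (ballMeasure n))‖ₑ := by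
    rw [Lp.enorm_def, Lp.enorm_def]
    refine (enorm_integral_le_lintegral_enorm _).trans ?_
    rw [← eLpNorm_one_eq_lintegral_enorm]
    simpa using eLpNorm_le_eLpNorm_mul_eLpNorm_of_nnnorm (Lp.aestronglyMeasurable f.1)
      (Lp.aestronglyMeasurable g.1) (fun x y => x * conj y) 1 (.of_forall fun x => by simp)
  simpa using ENNReal.toReal_mono (by finiteness) hholder

theorem pairing_eq_pairingL (f : Ap n p) (g : Ap n p') : pairing f g = pairingL p p' n f g := by
  have hconj : conjLp p' n g =ᵐ[ballMeasure n] fun w => conj ((g : Lp ℂ p' (ballMeasure n)) w) :=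
    ContinuousLinearMap.coeFn_compLpL _ _
  refine (integral_congr_ae ?_).trans
    (ContinuousLinearMap.lpPairing_eq_integral (ContinuousLinearMap.mul ℂ ℂ) _ _).symm
  filter_upwards [hconj] with w hw
  exact congrArg _ hw.symm

theorem pairing_smul_smul (a b : ℂ) (f : Ap n p) (g : Ap n p') :
    pairing (a • f) (b • g) = a * conj b * pairing f g := by
  simp only [pairing_eq_pairingL, map_smul, map_smulₛₗ, smul_apply, smul_eq_mul]
  ring

end Pairing

/-! ### The kernel of an operator, rescaled at a point near the boundary -/

section Operator

variable {n : ℕ} {p p' : ℝ≥0∞} [p.HolderConjugate p']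

theorem rpow_inv_mul_rpow_inv (hp : 1 < p) (hp' : 1 < p') {x : ℝ} (hx : 0 < x) :
    x ^ p'.toReal⁻¹ * x ^ p.toReal⁻¹ = x := by
  rw [← Real.rpow_add hx, add_comm, (holderConjugate_toReal p p' hp hp').inv_add_inv_eq_one,
    Real.rpow_one]

theorem mobiusBall_zero (z : unitBall n) :
    mobiusBall z ⟨0, Metric.mem_ball_self one_pos⟩ = z :=
  Subtype.ext (mobius_zero z.2)

variable [Fact (1 ≤ p)] [Fact (1 ≤ p')] (T : Ap n p →L[ℂ] Ap n p)

theorem norm_pairing_k (z : unitBall n) :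
    ‖pairing (T (k p z)) (k p' z)‖ =
      (1 - ‖(z : Cn n)‖ ^ 2) ^ (n + 1) * ‖pairing (T (K p z)) (K p' z)‖ := by
  have hz := one_sub_norm_sq_pos z.2
  rw [k, k, map_smul, pairing_smul_smul, norm_mul, norm_mul, RCLike.norm_conj, Complex.norm_real,
    Real.norm_of_nonneg (by positivity), ← Real.rpow_add hz, add_halves, ← Nat.cast_add_one,
    Real.rpow_natCast]

theorem norm_pairing_kNorm (z w : unitBall n) :
    ‖pairing (T (kNorm p p' z)) (kNorm p' p w)‖ =
      ((1 - ‖(z : Cn n)‖ ^ 2) ^ (n + 1)) ^ p'.toReal⁻¹ *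
        ((1 - ‖(w : Cn n)‖ ^ 2) ^ (n + 1)) ^ p.toReal⁻¹ * ‖pairing (T (K p z)) (K p' w)‖ := by
  have hz := one_sub_norm_sq_pos z.2
  have hw := one_sub_norm_sq_pos w.2
  rw [kNorm, kNorm, map_smul, pairing_smul_smul, norm_mul, norm_mul, RCLike.norm_conj,
    Complex.norm_real, Complex.norm_real, norm_K_two_rpow_two_div, norm_K_two_rpow_two_div,
    Real.inv_rpow (by positivity), Real.inv_rpow (by positivity), inv_inv, inv_inv,
    Real.norm_of_nonneg (by positivity), Real.norm_of_nonneg (by positivity)]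

theorem norm_kNorm_mul_norm_kNorm (hp : 1 < p) (hp' : 1 < p')
    (z : unitBall n) : ‖kNorm p p' z‖ * ‖kNorm p' p z‖ =
      (1 - ‖(z : Cn n)‖ ^ 2) ^ (n + 1) * (‖K p z‖ * ‖K p' z‖) := by
  have hz := one_sub_norm_sq_pos z.2
  have hpow := rpow_inv_mul_rpow_inv hp hp' (x := ((1 - ‖(z : Cn n)‖ ^ 2) ^ (n + 1))⁻¹)
    (by positivity)
  rw [norm_kNorm, norm_kNorm, mul_mul_mul_comm, ← mul_inv, hpow, inv_inv]

variable (p') in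
/-- The kernel `F_z(a, b) = (1 - |z|²)^{n+1} ⟨T(K_z · (K_a ∘ φ_z)), K_z · (K_b ∘ φ_z)⟩` of `T` in
the coordinates `φ_z` centred at `z`. -/
def rescaledKernel (z a b : unitBall n) : ℂ :=
  (((1 - ‖(z : Cn n)‖ ^ 2) ^ (n + 1) : ℝ) : ℂ) *
    pairing (T (toAp p (kernelTransform z a))) (toAp p' (kernelTransform z b))

variable (p') in
/-- The `(j, k)`-th term of the expansion of `F_z(a, a)`, of degree `j` in `\bar a` and `k`
in `a`. -/
def rescaledCoeff (z a : unitBall n) (q : ℕ × ℕ) : ℂ :=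
  (((1 - ‖(z : Cn n)‖ ^ 2) ^ (n + 1) : ℝ) : ℂ) *
    pairing (T (toAp p (kernelTerm z a q.1))) (toAp p' (kernelTerm z a q.2))

theorem norm_rescaledKernel (z a b : unitBall n) :
    ‖rescaledKernel p' T z a b‖ = (1 - ‖(z : Cn n)‖ ^ 2) ^ (n + 1) *
      (‖kernelFun (a : Cn n) z‖ * ‖kernelFun (b : Cn n) z‖ *
        ‖pairing (T (K p (mobiusBall z a))) (K p' (mobiusBall z b))‖) := by
  have hz := one_sub_norm_sq_pos z.2
  rw [rescaledKernel, kernelTransform, kernelTransform, map_smul, map_smul, map_smul,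
    pairing_smul_smul, toAp_kernelBdd, toAp_kernelBdd, norm_mul, norm_mul, norm_mul,
    RCLike.norm_conj, Complex.norm_real, Real.norm_of_nonneg (by positivity)]

theorem one_sub_norm_sq_mobiusBall (z a : unitBall n) :
    (1 - ‖(mobiusBall z a : Cn n)‖ ^ 2) ^ (n + 1) = (1 - ‖(z : Cn n)‖ ^ 2) ^ (n + 1) *
      ((1 - ‖(a : Cn n)‖ ^ 2) ^ (n + 1) * ‖kernelFun (a : Cn n) z‖ ^ 2) := by
  rw [mobiusBall, one_sub_norm_sq_mobius z.2 a.2, norm_one_sub_inner_comm, kernelFun, norm_inv,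
    norm_pow, div_pow, mul_pow, inv_pow, pow_right_comm]
  ring

theorem norm_rescaledKernel_self (z a : unitBall n) :
    ‖rescaledKernel p' T z a a‖ = ((1 - ‖(a : Cn n)‖ ^ 2) ^ (n + 1))⁻¹ *
      ‖pairing (T (k p (mobiusBall z a))) (k p' (mobiusBall z a))‖ := by
  have ha := one_sub_norm_sq_pos a.2
  rw [norm_rescaledKernel, norm_pairing_k, one_sub_norm_sq_mobiusBall]
  field_simp

theorem hasSum_rescaledCoeff (z a : unitBall n) (x : Metric.closedBall (0 : ℂ) 1) :
    HasSum (fun q => rescaledCoeff p' T z a q * (conj (x : ℂ) ^ q.1 * (x : ℂ) ^ q.2))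
      (rescaledKernel p' T z (x • a) (x • a)) := by
  have hsum := hasSum_sesqForm ((pairingL p p' n).comp T) (hasSum_kernelTerm z (x • a))
    (hasSum_kernelTerm z (x • a)) (summable_norm_toAp_kernelTerm z (x • a))
    (summable_norm_toAp_kernelTerm z (x • a))
  rw [rescaledKernel, pairing_eq_pairingL]
  refine (hsum.mul_left _).congr_fun fun q => ?_
  rw [ContinuousLinearMap.comp_apply, ← pairing_eq_pairingL, kernelTerm_smul, kernelTerm_smul,
    map_smul, map_smul, map_smul, pairing_smul_smul, rescaledCoeff, map_pow, Complex.conj_conj]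
  ring

theorem kernelTransform_zero (z : unitBall n) :
    kernelTransform z ⟨0, Metric.mem_ball_self one_pos⟩ = kernelBdd z := by
  rw [kernelTransform, mobiusBall_zero]
  simp [kernelFun]

theorem tsum_rescaledCoeff_zero (z a : unitBall n) :
    ∑' m, rescaledCoeff p' T z a (0, m) =
      rescaledKernel p' T z ⟨0, Metric.mem_ball_self one_pos⟩ a := by
  have hsum := (pairingL p p' n (T (K p z))).hasSum (hasSum_kernelTerm z a)
  simp only [← pairing_eq_pairingL] at hsum
  rw [rescaledKernel, kernelTransform_zero]
  simp only [rescaledCoeff, kernelTerm_zero, toAp_kernelBdd]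
  exact (hsum.mul_left _).tsum_eq

theorem exists_norm_rescaledCoeff_le (hp : 1 < p) (hp' : 1 < p') :
    ∃ M : ℝ, ∀ (z a : unitBall n) (q : ℕ × ℕ), ‖rescaledCoeff p' T z a q‖ ≤
      M * (((q.1 + n).choose n * ‖(a : Cn n)‖ ^ q.1) *
        ((q.2 + n).choose n * ‖(a : Cn n)‖ ^ q.2)) := by
  obtain ⟨C, hC⟩ := exists_norm_kNorm_le n p p' hp hp'
  obtain ⟨C', hC'⟩ := exists_norm_kNorm_le n p' p hp' hp
  refine ⟨‖T‖ * (C * C'), fun z a q => ?_⟩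
  have hz := one_sub_norm_sq_pos z.2
  set c := ((q.1 + n).choose n : ℝ) * ‖(a : Cn n)‖ ^ q.1
  set c' := ((q.2 + n).choose n : ℝ) * ‖(a : Cn n)‖ ^ q.2
  have hpair : ‖pairing (T (toAp p (kernelTerm z a q.1))) (toAp p' (kernelTerm z a q.2))‖ ≤
      ‖T‖ * (c * ‖K p z‖) * (c' * ‖K p' z‖) := by
    refine (norm_pairing_le _ _).trans ?_
    gcongr
    · exact T.le_opNorm_of_le (norm_toAp_kernelTerm_le z a q.1)
    · exact norm_toAp_kernelTerm_le z a q.2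
  rw [rescaledCoeff, norm_mul, Complex.norm_real, Real.norm_of_nonneg (by positivity)]
  calc _ ≤ (1 - ‖(z : Cn n)‖ ^ 2) ^ (n + 1) *
        (‖T‖ * (c * ‖K p z‖) * (c' * ‖K p' z‖)) := by gcongr
    _ = ‖T‖ * (‖kNorm p p' z‖ * ‖kNorm p' p z‖) * (c * c') := by
      rw [norm_kNorm_mul_norm_kNorm hp hp']
      ring
    _ ≤ ‖T‖ * (C * C') * (c * c') := by
      gcongr
      exacts [(norm_nonneg _).trans (hC z), hC z, hC' z]

theorem eventually_toBoundary_iff {P : unitBall n → Prop} :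
    (∀ᶠ z in toBoundary n, P z) ↔ ∃ δ > 0, ∀ z : unitBall n, 1 - ‖(z : Cn n)‖ ^ 2 < δ → P z := by
  rw [toBoundary, ((nhdsLT_basis (1 : ℝ)).comap _).eventually_iff]
  constructor
  · rintro ⟨η, hη, h⟩
    refine ⟨1 - η, sub_pos.mpr hη, fun z hz => h ⟨?_, mem_ball_zero_iff.mp z.2⟩⟩
    nlinarith [norm_nonneg (z : Cn n), mem_ball_zero_iff.mp z.2]
  · rintro ⟨δ, hδ, h⟩
    refine ⟨1 - δ / 2, by linarith, fun z hz => h z ?_⟩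
    nlinarith [hz.1, hz.2]

theorem one_sub_norm_sq_mobiusBall_le (z : unitBall n) {a : unitBall n}
    (ha : ‖(a : Cn n)‖ ≤ 1 / 2) :
    1 - ‖(mobiusBall z a : Cn n)‖ ^ 2 ≤ 4 * (1 - ‖(z : Cn n)‖ ^ 2) := by
  have hz := one_sub_norm_sq_pos z.2
  have hden : (1 / 2) ^ 2 ≤ ‖1 - inner ℂ (z : Cn n) a‖ ^ 2 := by
    rw [norm_one_sub_inner_comm]
    gcongr
    linarith [one_sub_norm_le (a : Cn n) z.2]
  rw [mobiusBall, one_sub_norm_sq_mobius z.2 a.2, div_le_iff₀ (by positivity)]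
  nlinarith [sq_nonneg ‖(a : Cn n)‖]

theorem eventually_norm_rescaledKernel_self_le
    (h : Tendsto (fun z : unitBall n => ‖pairing (T (k p z)) (k p' z)‖) (toBoundary n) (𝓝 0))
    {ε : ℝ} (hε : 0 < ε) :
    ∀ᶠ z in toBoundary n, ∀ a : unitBall n, ‖(a : Cn n)‖ ≤ 1 / 2 →
      ‖rescaledKernel p' T z a a‖ ≤ ε := by
  obtain ⟨δ, hδ, hsmall⟩ := eventually_toBoundary_iff.mp
    (h.eventually (gt_mem_nhds (show 0 < ε / 2 ^ (n + 1) by positivity)))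
  refine eventually_toBoundary_iff.mpr ⟨δ / 4, by positivity, fun z hz a ha => ?_⟩
  have hberezin := hsmall (mobiusBall z a) (by linarith [one_sub_norm_sq_mobiusBall_le z ha])
  have hfactor : ((1 - ‖(a : Cn n)‖ ^ 2) ^ (n + 1))⁻¹ ≤ 2 ^ (n + 1) := by
    rw [inv_le_comm₀ (pow_pos (one_sub_norm_sq_pos a.2) _) (by positivity), ← inv_pow]
    gcongr
    nlinarith [norm_nonneg (a : Cn n)]
  calc ‖rescaledKernel p' T z a a‖ ≤ 2 ^ (n + 1) * (ε / 2 ^ (n + 1)) := by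
        rw [norm_rescaledKernel_self]
        gcongr
    _ = ε := by field_simp

theorem eventually_norm_rescaledKernel_zero_lt (hp : 1 < p) (hp' : 1 < p')
    (h : Tendsto (fun z : unitBall n => ‖pairing (T (k p z)) (k p' z)‖) (toBoundary n) (𝓝 0))
    {t : ℝ} (ht0 : 0 ≤ t) (ht1 : t < 1) {ε : ℝ} (hε : 0 < ε) :
    ∀ᶠ z in toBoundary n, ∀ a : unitBall n, ‖(a : Cn n)‖ ≤ t →
      ‖rescaledKernel p' T z ⟨0, Metric.mem_ball_self one_pos⟩ a‖ < ε := by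
  obtain ⟨M, hM⟩ := exists_norm_rescaledCoeff_le (p' := p') T hp hp'
  have hsum := summable_choose_mul_pow n ht0 ht1
  have hlim : Tendsto (fun i : unitBall n × {a : unitBall n // ‖(a : Cn n)‖ ≤ t} =>
      ∑' m, rescaledCoeff p' T i.1 i.2 (0, m)) (comap Prod.fst (toBoundary n)) (𝓝 0) := by
    refine tendsto_tsum_coeff_zero (R := 1 / 2) ((hsum.mul_of_nonneg hsum (fun _ => by positivity)
      fun _ => by positivity).mul_left |M|) (fun i q => (hM i.1 i.2 q).trans ?_) (by norm_num)
      fun δ hδ => ?_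
    · gcongr
      exacts [le_abs_self M, i.2.2, i.2.2]
    · rw [eventually_comap]
      filter_upwards [eventually_norm_rescaledKernel_self_le T h hδ] with z hz
      rintro ⟨_, a, ha⟩ rfl x hx
      let y : Metric.closedBall (0 : ℂ) 1 := ⟨x, mem_closedBall_zero_iff.mpr (by linarith)⟩
      rw [(hasSum_rescaledCoeff T _ a y).tsum_eq]
      refine hz _ ?_
      calc ‖x • (a : Cn n)‖ = ‖x‖ * ‖(a : Cn n)‖ := norm_smul _ _
        _ ≤ 1 / 2 := (mul_le_of_le_one_right (norm_nonneg x) (ha.trans ht1.le)).trans hx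
  have hsmall := Metric.tendsto_nhds.mp hlim ε hε
  rw [eventually_comap] at hsmall
  filter_upwards [hsmall] with z hz a ha
  simpa only [tsum_rescaledCoeff_zero, dist_zero_right] using hz (z, ⟨a, ha⟩) rfl

theorem norm_pairing_kNorm_mobiusBall (hp : 1 < p) (hp' : 1 < p') (z b : unitBall n) :
    ‖pairing (T (kNorm p p' z)) (kNorm p' p (mobiusBall z b))‖ =
      ((1 - ‖(b : Cn n)‖ ^ 2) ^ (n + 1) * ‖kernelFun (b : Cn n) z‖ ^ 2) ^ p.toReal⁻¹ *
        ‖kernelFun (b : Cn n) z‖⁻¹ *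
          ‖rescaledKernel p' T z ⟨0, Metric.mem_ball_self one_pos⟩ b‖ := by
  have hz := one_sub_norm_sq_pos z.2
  have hb := one_sub_norm_sq_pos b.2
  have hker : ‖kernelFun (b : Cn n) z‖ ≠ 0 :=
    norm_ne_zero_iff.mpr (inv_ne_zero (pow_ne_zero _ (one_sub_inner_ne_zero b.2 z.2)))
  have hker0 : ‖kernelFun (0 : Cn n) z‖ = 1 := by simp [kernelFun]
  have hpow := rpow_inv_mul_rpow_inv hp hp' (x := (1 - ‖(z : Cn n)‖ ^ 2) ^ (n + 1)) (by positivity)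
  rw [norm_pairing_kNorm, norm_rescaledKernel, hker0, one_mul, mobiusBall_zero,
    one_sub_norm_sq_mobiusBall, Real.mul_rpow (by positivity) (by positivity), ← mul_assoc (_ ^ _),
    hpow]
  field_simp

theorem self_mem_D (z : unitBall n) {r : ℝ} (hr : 0 < r) : z ∈ D z r := by
  simpa [D, beta, rho, mobius_self z.2] using hr.le

theorem norm_mobiusBall_le_of_mem_D {z w : unitBall n} {r : ℝ} (h : w ∈ D z r) :
    ‖(mobiusBall z w : Cn n)‖ ≤ (Real.exp (2 * r) - 1) / (Real.exp (2 * r) + 1) := by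
  have hρ : 0 < 1 - ‖(mobiusBall z w : Cn n)‖ := one_sub_norm_pos (mobiusBall z w).2
  have hlog : 1 / 2 * Real.log ((1 + ‖(mobiusBall z w : Cn n)‖) /
    (1 - ‖(mobiusBall z w : Cn n)‖)) ≤ r := h
  rw [one_div, inv_mul_le_iff₀ two_pos, Real.log_le_iff_le_exp (by positivity),
    div_le_iff₀ hρ] at hlog
  rw [le_div_iff₀ (by positivity)]
  linarith

theorem exists_norm_pairing_kNorm_mobiusBall_le (hp : 1 < p) (hp' : 1 < p') {t : ℝ} (ht : t < 1) :
    ∃ κ > 0, ∀ z b : unitBall n, ‖(b : Cn n)‖ ≤ t →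
      ‖pairing (T (kNorm p p' z)) (kNorm p' p (mobiusBall z b))‖ ≤
        κ * ‖rescaledKernel p' T z ⟨0, Metric.mem_ball_self one_pos⟩ b‖ := by
  have : 0 < 1 - t := sub_pos.mpr ht
  refine ⟨((((1 - t) ^ (n + 1))⁻¹) ^ 2) ^ p.toReal⁻¹ * 2 ^ (n + 1), by positivity,
    fun z b hb => ?_⟩
  have hb0 := one_sub_norm_sq_pos b.2
  have hle : ‖kernelFun (b : Cn n) z‖ ≤ ((1 - t) ^ (n + 1))⁻¹ :=
    (norm_kernelFun_le b.2 z.2).trans (by gcongr)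
  have hinv : ‖kernelFun (b : Cn n) z‖⁻¹ ≤ 2 ^ (n + 1) := by
    rw [kernelFun, norm_inv, inv_inv, norm_pow]
    gcongr
    calc ‖1 - inner ℂ (b : Cn n) z‖ ≤ ‖(1 : ℂ)‖ + ‖(b : Cn n)‖ * ‖(z : Cn n)‖ :=
          (norm_sub_le _ _).trans (by gcongr; exact norm_inner_le_norm _ _)
      _ ≤ 1 + 1 * 1 := by
          gcongr
          exacts [norm_one.le, (mem_ball_zero_iff.mp b.2).le, (mem_ball_zero_iff.mp z.2).le]
      _ = 2 := by norm_num
  have hone : (1 - ‖(b : Cn n)‖ ^ 2) ^ (n + 1) ≤ 1 :=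
    pow_le_one₀ hb0.le (sub_le_self _ (sq_nonneg _))
  rw [norm_pairing_kNorm_mobiusBall T hp hp']
  gcongr
  exact (mul_le_of_le_one_left (sq_nonneg _) hone).trans (by gcongr)

theorem vanishesOnDiscs_of_tendsto (hp : 1 < p) (hp' : 1 < p')
    (h : Tendsto (fun z : unitBall n => ‖pairing (T (k p z)) (k p' z)‖) (toBoundary n) (𝓝 0))
    {r : ℝ} (hr : 0 < r) : VanishesOnDiscs p' T r := by
  have hexp : 1 < Real.exp (2 * r) := Real.one_lt_exp_iff.mpr (by linarith)
  set t := (Real.exp (2 * r) - 1) / (Real.exp (2 * r) + 1) with ht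
  have ht0 : 0 ≤ t := div_nonneg (by linarith) (by linarith)
  have ht1 : t < 1 := by rw [ht, div_lt_one (by linarith)]; linarith
  obtain ⟨κ, hκ, hbound⟩ := exists_norm_pairing_kNorm_mobiusBall_le (p' := p') T hp hp' ht1
  refine ENNReal.tendsto_nhds_zero.mpr fun ε hε => ?_
  obtain ⟨δ, hδ, hδε⟩ := ENNReal.lt_iff_exists_nnreal_btwn.mp hε
  have hδ : (0 : ℝ) < δ := by exact_mod_cast hδ
  filter_upwards [eventually_norm_rescaledKernel_zero_lt T hp hp' h ht0 ht1 (div_pos hδ hκ)]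
    with z hz
  refine iSup₂_le fun w hw => le_trans ?_ hδε.le
  have hw := norm_mobiusBall_le_of_mem_D hw
  have hpair : ‖pairing (T (kNorm p p' z)) (kNorm p' p w)‖ ≤ δ :=
    calc ‖pairing (T (kNorm p p' z)) (kNorm p' p w)‖
        ≤ κ * ‖rescaledKernel p' T z ⟨0, Metric.mem_ball_self one_pos⟩ (mobiusBall z w)‖ := by
          simpa only [mobiusBall_mobiusBall] using hbound z (mobiusBall z w) hw
      _ ≤ κ * (δ / κ) := by gcongr; exact (hz _ hw).le
      _ = δ := by field_simp
  exact enorm_le_coe.mpr (NNReal.coe_le_coe.mp hpair)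

theorem tendsto_of_vanishesOnDiscs (hp : 1 < p) (hp' : 1 < p') {r : ℝ} (hr : 0 < r)
    (h : VanishesOnDiscs p' T r) :
    Tendsto (fun z : unitBall n => ‖pairing (T (k p z)) (k p' z)‖) (toBoundary n) (𝓝 0) := by
  have heq (z : unitBall n) : ‖pairing (T (k p z)) (k p' z)‖ =
      ‖pairing (T (kNorm p p' z)) (kNorm p' p z)‖ := by
    rw [norm_pairing_k, norm_pairing_kNorm,
      rpow_inv_mul_rpow_inv hp hp' (pow_pos (one_sub_norm_sq_pos z.2) _)]
  have hdiag : Tendsto (fun z : unitBall n => ‖pairing (T (kNorm p p' z)) (kNorm p' p z)‖ₑ)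
      (toBoundary n) (𝓝 0) :=
    tendsto_of_tendsto_of_tendsto_of_le_of_le tendsto_const_nhds h (fun _ => zero_le)
      fun z => le_iSup₂ (f := fun w (_ : w ∈ D z r) =>
        ‖pairing (T (kNorm p p' z)) (kNorm p' p w)‖ₑ) z (self_mem_D z hr)
  simpa only [heq, toReal_enorm, ENNReal.toReal_zero, Function.comp_def] using
    (ENNReal.continuousAt_toReal ENNReal.zero_ne_top).tendsto.comp hdiag

end Operator

end Bergman

end

/-- For a bounded operator `T` on the Bergman space `A^p` of the unit ball of `ℂⁿ`, `1 < p < ∞`,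
with conjugate exponent `p'`, the following are equivalent: (a) for all `r > 0`, the supremum over
`w ∈ D(z, r)` of `|⟨T k_z^{(p)}, k_w^{(p')}⟩|` tends to zero as `|z| → 1⁻`; (b) the same for some
`r > 0`; (c) the Berezin transform `⟨T k_z, k_z⟩` tends to zero as `|z| → 1⁻`. -/
theorem proposition2p7 (n : ℕ) (hn : 1 ≤ n) (p p' : ℝ≥0∞) [Fact (1 ≤ p)] (hp : 1 < p)
    (hp_top : p < ∞) (hpp' : 1 / p + 1 / p' = 1) (T : Bergman.Ap n p →L[ℂ] Bergman.Ap n p) :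
    List.TFAE [
      ∀ r : ℝ, 0 < r → Bergman.VanishesOnDiscs p' T r,
      ∃ r : ℝ, 0 < r ∧ Bergman.VanishesOnDiscs p' T r,
      Tendsto (fun z : Bergman.unitBall n =>
          ‖Bergman.pairing (T (Bergman.k p z)) (Bergman.k p' z)‖)
        (Bergman.toBoundary n) (𝓝 0)] := by
  have hconj : p.HolderConjugate p' := ENNReal.holderConjugate_iff.mpr (by simpa using hpp')
  have hp' : 1 < p' := (ENNReal.HolderConjugate.lt_top_iff_one_lt p p').mp hp_top
  have : Fact (1 ≤ p') := ⟨hp'.le⟩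
  tfae_have 1 → 2 := fun h => ⟨1, one_pos, h 1 one_pos⟩
  tfae_have 2 → 3 := fun ⟨_, hr, h⟩ => Bergman.tendsto_of_vanishesOnDiscs T hp hp' hr h
  tfae_have 3 → 1 := fun h _ hr => Bergman.vanishesOnDiscs_of_tendsto T hp hp' h hr
  tfae_finish
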